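/- \textbf{Definitions.} A \emph{2-colored digraph} is a nonempty, finite or infinite, (weakly) connected digraph $K=(V,E_1,E_2)$ whose edges are colored 1 or 2; edges in $E_i$ are called $i$-edges. Such a $K$ is a \emph{WC-graph} if it satisfies the following axioms. (A1) For $i=1,2$, each connected component of $(V,E_i)$ is a finite simple directed path; these paths are called the $i$-lines. For a vertex $v$, let $t_i(v)$ (resp. $h_i(v)$) be the number of edges in the part of the $i$-line through $v$ from its first vertex to $v$ (resp. from $v$ to its last vertex). If $(u,v)$ is an $i$-edge, write $v=F_i(u)$ and $u=F_i^{-1}(v)$. (A2) Each $i$-line $P$ ($i=1,2$) contains a vertex $r$ such that every edge $(u,v)$ of $P$ in the part from the first vertex to $r$ satisfies $t_{3-i}(v)=t_{3-i}(u)-1$ and $h_{3-i}(v)=h_{3-i}(u)$, and every edge $(u,v)$ of $P$ in the part from $r$ to the last vertex satisfies $t_{3-i}(v)=t_{3-i}(u)$ and $h_{3-i}(v)=h_{3-i}(u)+1$. (A3) Define the label of an $i$-edge by $\ell(u,v)=0$ if $h_{3-i}(u)=h_{3-i}(v)$ and $\ell(u,v)=1$ otherwise. (a) If a vertex $u$ has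 two outgoing edges $(u,v),(u,v')$ and $\ell(u,v)=0$, then $\ell(u,v')=1$ and $F_2F_1(u)=F_1F_2(u)$ (both sides being defined). (b) If a vertex $v$ has two incoming edges $(u,v),(u',v)$ and $\ell(u,v)=1$, then $\ell(u',v)=0$ and $F_2^{-1}F_1^{-1}(v)=F_1^{-1}F_2^{-1}(v)$ (both sides being defined). For integers $a,b\ge 0$ let $\Gamma_{a,b}=P_a\times P_b$ be the Cartesian product of directed paths with $a$ and $b$ edges. A \emph{covering} over $\Gamma_{a,b}$ is a nonempty (finite or infinite) connected digraph $G$ along with a homomorphism $\gamma:G\to\Gamma_{a,b}$ that maps, for each vertex $v$ of $G$, the subgraph formed by $v$ and the edges incident with $v$ isomorphically onto the corresponding subgraph at $\gamma(v)$. Coverings $(G,\gamma)$ over $\Gamma_{a,b}$ and $(G',\gamma')$ over $\Gamma_{a',b'}$ are isomorphic if $a=a'$, $b=b'$ and there is a digraph isomorphism $\varphi:G\to G'$ with $\gamma'\varphi=\gamma$. The \emph{left sail} of size $a$ has the vertices $(i,j)$ with $0\le i\le j\le a$, the \emph{right sail} of size $b$ has the vertices $(i,j)$ with $0\le j\le i\le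 b$; in both, the 1-edges are all pairs $((i,j),(i+1,j))$, the 2-edges are all pairs $((i,j),(i,j+1))$, and the diagonal consists of the vertices $(i,i)$. Given a covering $(G,\gamma)$ over $\Gamma_{a,b}$, the preimage of each path $(P_a,\cdot)$ of $\Gamma_{a,b}$ is a collection of disjoint paths $Q$ of length $a$, and the preimage of each path $(\cdot,P_b)$ is a collection of disjoint paths $Q$ of length $b$. Let $K(G,\gamma)$ be the 2-colored digraph obtained by replacing each of the former by a copy of the left sail of size $a$ and each of the latter by a copy of the right sail of size $b$, the vertices of $Q$ being identified, in their natural order, with the diagonal of the sail. \textbf{Proposition.} For every covering $(G,\gamma)$ over a grid $\Gamma_{a,b}$, $a,b\ge0$, the 2-colored digraph $K(G,\gamma)$ is a WC-graph, and $(G,\gamma)\mapsto K(G,\gamma)$ induces a bijection from the set of isomorphism classes of coverings over the grids $\Gamma_{a,b}$, for all $a,b\ge 0$, onto the set of isomorphism classes (with respect to color-preserving isomorphisms) of WC-graphs. -/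

import Mathlib

universe u

/-! ## 2-coloured digraphs and the axioms (A1), (A2), (A3) -/

/-- The two edge colours. -/
inductive Color : Type
  | one : Color
  | two : Color

/-- The other colour, `3 - i`. -/
def Color.other : Color → Color
  | .one => .two
  | .two => .one

/-- A relation is (weakly) connected on a nonempty vertex set: any two vertices are joined by an
undirected path. -/
def WeaklyConnected {V : Type u} (r : V → V → Prop) : Prop :=
  Nonempty V ∧ ∀ u v : V, Relation.EqvGen r u v

/-- A 2-coloured digraph, finite or infinite: `E i u v` says that `(u, v)` is an `i`-edge.
The two colour classes may share a pair `(u, v)` a priori (two parallel edges of different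
colours); parallel edges of the same colour are ruled out by (A1) anyway. -/
structure TwoColoredDigraph : Type (u + 1) where
  V : Type u
  E : Color → V → V → Prop

namespace TwoColoredDigraph

variable (K : TwoColoredDigraph.{u})

/-- Weak connectedness of the underlying (uncoloured) digraph, with at least one vertex. -/
def Connected : Prop :=
  WeaklyConnected (fun u v : K.V => ∃ i, K.E i u v)

/-- `v` and `w` lie in the same connected component of `(V, E_i)`. -/
def SameLine (i : Color) (v w : K.V) : Prop :=
  Relation.EqvGen (K.E i) v w

/-- There is a directed path (possibly of length 0) of colour `i` from `v` to `w`. -/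
def Reach (i : Color) (v w : K.V) : Prop :=
  Relation.ReflTransGen (K.E i) v w

/-- (A1): every connected component of `(V, E_i)` is a finite simple directed path
`p 0 → p 1 → ⋯ → p k`. -/
def A1 : Prop :=
  ∀ (i : Color) (v : K.V), ∃ (k : ℕ) (p : Fin (k + 1) → K.V),
    Function.Injective p ∧
    Set.range p = {w | K.SameLine i v w} ∧
    ∀ s t : Fin (k + 1), K.E i (p s) (p t) ↔ (s : ℕ) + 1 = (t : ℕ)

/-- `t_i(v)`: the length of the part of the `i`-line through `v` from its first vertex to `v`,
that is, the number of vertices strictly before `v` on it. -/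
noncomputable def t (i : Color) (v : K.V) : ℕ :=
  Set.ncard {w : K.V | Relation.TransGen (K.E i) w v}

/-- `h_i(v)`: the length of the part of the `i`-line through `v` from `v` to its last vertex,
that is, the number of vertices strictly after `v` on it. -/
noncomputable def h (i : Color) (v : K.V) : ℕ :=
  Set.ncard {w : K.V | Relation.TransGen (K.E i) v w}

/-- (A2): every `i`-line (given by a vertex `x` on it) contains a critical vertex `r`. -/
def A2 : Prop :=
  ∀ (i : Color) (x : K.V), ∃ r : K.V, K.SameLine i x r ∧
    (∀ u v : K.V, K.E i u v → K.Reach i v r →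
      K.t i.other u = K.t i.other v + 1 ∧ K.h i.other v = K.h i.other u) ∧
    (∀ u v : K.V, K.E i u v → K.Reach i r u →
      K.t i.other v = K.t i.other u ∧ K.h i.other v = K.h i.other u + 1)

/-- The label of an `i`-edge `(u, v)`: `0` if `h_{3-i}(u) = h_{3-i}(v)`, and `1` otherwise. -/
noncomputable def label (i : Color) (u v : K.V) : ℕ :=
  if K.h i.other u = K.h i.other v then 0 else 1

/-- (A3): (a) for edges `(u, v)`, `(u, v')` of colours `i`, `3-i` with `ℓ(u, v) = 0`, one has
`ℓ(u, v') = 1` and `F_{3-i} F_i (u) = F_i F_{3-i} (u)` (both being defined);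
(b) the same with all edges reversed and the labels exchanged. -/
def A3 : Prop :=
  (∀ (i : Color) (u v v' : K.V), K.E i u v → K.E i.other u v' → K.label i u v = 0 →
    K.label i.other u v' = 1 ∧ ∃ w : K.V, K.E i.other v w ∧ K.E i v' w) ∧
  (∀ (i : Color) (v u u' : K.V), K.E i u v → K.E i.other u' v → K.label i u v = 1 →
    K.label i.other u' v = 0 ∧ ∃ w : K.V, K.E i.other w u ∧ K.E i w u')

/-- WC-graphs: connected 2-coloured digraphs satisfying (A1), (A2) and (A3). -/
def IsWC : Prop :=
  K.Connected ∧ K.A1 ∧ K.A2 ∧ K.A3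

/-- Isomorphism of 2-coloured digraphs (colours are preserved). -/
def Isomorphic (K L : TwoColoredDigraph.{u}) : Prop :=
  ∃ e : K.V ≃ L.V, ∀ (i : Color) (x y : K.V), L.E i (e x) (e y) ↔ K.E i x y

end TwoColoredDigraph

/-- WC-graphs, bundled. -/
abbrev WCGraph : Type (u + 1) :=
  {K : TwoColoredDigraph.{u} // K.IsWC}

/-- Two WC-graphs are identified when they are isomorphic. -/
def wcSetoid : Setoid WCGraph.{u} where
  r K L := K.1.Isomorphic L.1
  iseqv :=
    { refl := fun _ => ⟨Equiv.refl _, fun _ _ _ => Iff.rfl⟩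
      symm := by
        rintro K L ⟨e, he⟩
        refine ⟨e.symm, fun i x y => ?_⟩
        have := he i (e.symm x) (e.symm y)
        simp only [Equiv.apply_symm_apply] at this
        exact this.symm
      trans := by
        rintro K L M ⟨e, he⟩ ⟨f, hf⟩
        exact ⟨e.trans f, fun i x y => (hf i (e x) (e y)).trans (he i x y)⟩ }

/-- The isomorphism classes of WC-graphs. -/
def WCClass : Type (u + 1) := Quotient wcSetoid.{u}

/-! ## Grids and coverings -/

/-- The grid `Γ_{a,b} = P_a × P_b`, the Cartesian product of directed paths with `a` and `b`
edges. -/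
def grid (a b : ℕ) : Digraph (Fin (a + 1) × Fin (b + 1)) where
  Adj p q := ((p.1 : ℕ) + 1 = (q.1 : ℕ) ∧ p.2 = q.2) ∨ (p.1 = q.1 ∧ (p.2 : ℕ) + 1 = (q.2 : ℕ))

/-- The vertices of the 1-neighbourhood of `v`: `v` and the ends of the edges incident with `v`. -/
def nbhdVerts {V : Type*} (G : Digraph V) (v : V) : Set V :=
  {w | w = v ∨ G.Adj v w ∨ G.Adj w v}

/-- The edges of the 1-neighbourhood of `v`: the edges incident with `v`. -/
def nbhdAdj {V : Type*} (G : Digraph V) (v x y : V) : Prop :=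
  G.Adj x y ∧ (x = v ∨ y = v)

/-- A covering over a grid `Γ_{a,b}`, for some `a, b`: a nonempty connected digraph with a
homomorphism to `Γ_{a,b}` mapping the 1-neighbourhood of each vertex `v` isomorphically onto the
1-neighbourhood of the image of `v`. -/
structure GridCovering : Type (u + 1) where
  V : Type u
  G : Digraph V
  a : ℕ
  b : ℕ
  γ : V → Fin (a + 1) × Fin (b + 1)
  connected : WeaklyConnected G.Adj
  hom : ∀ x y : V, G.Adj x y → (grid a b).Adj (γ x) (γ y)
  nbhd_bijOn : ∀ v : V, Set.BijOn γ (nbhdVerts G v) (nbhdVerts (grid a b) (γ v))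
  nbhd_adj : ∀ v : V, ∀ x ∈ nbhdVerts G v, ∀ y ∈ nbhdVerts G v,
    (nbhdAdj G v x y ↔ nbhdAdj (grid a b) (γ v) (γ x) (γ y))

namespace GridCovering

/-- Isomorphism of coverings: they are over the same grid, and there is a digraph isomorphism
compatible with the maps to the grid. -/
def Isomorphic (C D : GridCovering.{u}) : Prop :=
  C.a = D.a ∧ C.b = D.b ∧ ∃ e : C.V ≃ D.V,
    (∀ x y : C.V, D.G.Adj (e x) (e y) ↔ C.G.Adj x y) ∧
    (∀ x : C.V, ((D.γ (e x)).1 : ℕ) = ((C.γ x).1 : ℕ) ∧ ((D.γ (e x)).2 : ℕ) = ((C.γ x).2 : ℕ))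

end GridCovering

/-- Two coverings are identified when they are isomorphic. -/
def coveringSetoid : Setoid GridCovering.{u} where
  r C D := C.Isomorphic D
  iseqv :=
    { refl := fun _ => ⟨rfl, rfl, Equiv.refl _, fun _ _ => Iff.rfl, fun _ => ⟨rfl, rfl⟩⟩
      symm := by
        rintro C D ⟨ha, hb, e, he, hγ⟩
        refine ⟨ha.symm, hb.symm, e.symm, fun x y => ?_, fun x => ?_⟩
        · have := he (e.symm x) (e.symm y)
          simp only [Equiv.apply_symm_apply] at this
          exact this.symm
        · have := hγ (e.symm x)
          simp only [Equiv.apply_symm_apply] at this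
          exact ⟨this.1.symm, this.2.symm⟩
      trans := by
        rintro C D F ⟨ha, hb, e, he, hγ⟩ ⟨ha', hb', f, hf, hδ⟩
        exact ⟨ha.trans ha', hb.trans hb', e.trans f,
          fun x y => (hf (e x) (e y)).trans (he x y),
          fun x => ⟨(hδ (e x)).1.trans (hγ x).1, (hδ (e x)).2.trans (hγ x).2⟩⟩ }

/-- The isomorphism classes of coverings over grids `Γ_{a,b}`, for all `a, b`. -/
def CoveringClass : Type (u + 1) := Quotient coveringSetoid.{u}

/-! ## Replacing the path preimages by sails -/

/-- The left sail `K(a,0)`: vertices `(i, j)` with `0 ≤ i ≤ j ≤ a`, 1-edges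
`(i, j) → (i + 1, j)`, 2-edges `(i, j) → (i, j + 1)`; the diagonal is `{(i, i)}`. -/
def leftSail (a : ℕ) : TwoColoredDigraph.{0} where
  V := {p : Fin (a + 1) × Fin (a + 1) // p.1 ≤ p.2}
  E
    | .one => fun p q => (p.1.1 : ℕ) + 1 = (q.1.1 : ℕ) ∧ p.1.2 = q.1.2
    | .two => fun p q => p.1.1 = q.1.1 ∧ (p.1.2 : ℕ) + 1 = (q.1.2 : ℕ)

/-- The right sail `K(0,b)`: vertices `(i, j)` with `0 ≤ j ≤ i ≤ b`, 1-edges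
`(i, j) → (i + 1, j)`, 2-edges `(i, j) → (i, j + 1)`; the diagonal is `{(i, i)}`. -/
def rightSail (b : ℕ) : TwoColoredDigraph.{0} where
  V := {p : Fin (b + 1) × Fin (b + 1) // p.2 ≤ p.1}
  E
    | .one => fun p q => (p.1.1 : ℕ) + 1 = (q.1.1 : ℕ) ∧ p.1.2 = q.1.2
    | .two => fun p q => p.1.1 = q.1.1 ∧ (p.1.2 : ℕ) + 1 = (q.1.2 : ℕ)

namespace GridCovering

variable (C : GridCovering.{u})

/-- The edges of `G` lying over the paths `(P_a, ·)` of the grid. -/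
def HEdge (x y : C.V) : Prop :=
  C.G.Adj x y ∧ (C.γ x).2 = (C.γ y).2

/-- The edges of `G` lying over the paths `(·, P_b)` of the grid. -/
def VEdge (x y : C.V) : Prop :=
  C.G.Adj x y ∧ (C.γ x).1 = (C.γ y).1

/-- `x` and `y` lie on one path `Q` over some `(P_a, ·)`, and `x` is not after `y` on `Q`. -/
def HReach (x y : C.V) : Prop := Relation.ReflTransGen C.HEdge x y

/-- `x` and `y` lie on one path `Q` over some `(·, P_b)`, and `x` is not after `y` on `Q`. -/
def VReach (x y : C.V) : Prop := Relation.ReflTransGen C.VEdge x y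

/-- `p = (x, y)` is a vertex of the left sail `{(x, y) ∈ Q × Q : x ≤ y}` put in place of a path
`Q` over some `(P_a, ·)`. If `Q` is `q_0 → ⋯ → q_a` then `(q_i, q_j)` is the copy of the vertex
`(i, j)` of `leftSail a`, see `leftSail_copy`. -/
def IsLeft (p : C.V × C.V) : Prop := C.HReach p.1 p.2

/-- `p = (x, y)` is a vertex of the right sail `{(x, y) ∈ Q × Q : y ≤ x}` put in place of a path
`Q` over some `(·, P_b)`. If `Q` is `q_0 → ⋯ → q_b` then `(q_i, q_j)` is the copy of the vertex
`(i, j)` of `rightSail b`, see `rightSail_copy`. -/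
def IsRight (p : C.V × C.V) : Prop := C.VReach p.2 p.1

/-- The 2-coloured digraph obtained from a covering by replacing each path over some `(P_a, ·)`
by a left sail, and each path over some `(·, P_b)` by a right sail. A vertex `x` of `G` is
identified with the diagonal vertex `(x, x)` of the left sail and of the right sail put in place
of the two paths through `x`; left and right sails share no other vertices. -/
def sailGraph : TwoColoredDigraph.{u} where
  V := {p : C.V × C.V // C.IsLeft p ∨ C.IsRight p}
  E
    | .one => fun p q => p.1.2 = q.1.2 ∧
        ((C.IsLeft p.1 ∧ C.IsLeft q.1 ∧ C.HEdge p.1.1 q.1.1) ∨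
          (C.IsRight p.1 ∧ C.IsRight q.1 ∧ C.VEdge p.1.1 q.1.1))
    | .two => fun p q => p.1.1 = q.1.1 ∧
        ((C.IsLeft p.1 ∧ C.IsLeft q.1 ∧ C.HEdge p.1.2 q.1.2) ∨
          (C.IsRight p.1 ∧ C.IsRight q.1 ∧ C.VEdge p.1.2 q.1.2))

theorem HEdge.coord {C : GridCovering.{u}} {x y : C.V} (h : C.HEdge x y) :
    ((C.γ x).1 : ℕ) + 1 = ((C.γ y).1 : ℕ) ∧ (C.γ x).2 = (C.γ y).2 := by
  rcases C.hom x y h.1 with h1 | h1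
  · exact h1
  · have := congrArg Fin.val h.2
    omega

theorem VEdge.coord {C : GridCovering.{u}} {x y : C.V} (h : C.VEdge x y) :
    (C.γ x).1 = (C.γ y).1 ∧ ((C.γ x).2 : ℕ) + 1 = ((C.γ y).2 : ℕ) := by
  rcases C.hom x y h.1 with h1 | h1
  · have := congrArg Fin.val h.2
    omega
  · exact h1

theorem HReach.coord {C : GridCovering.{u}} {x y : C.V} (h : C.HReach x y) :
    ((C.γ x).1 : ℕ) ≤ ((C.γ y).1 : ℕ) ∧ (C.γ x).2 = (C.γ y).2 := by
  induction h with
  | refl => exact ⟨le_rfl, rfl⟩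
  | tail _ h ih => exact ⟨by have := h.coord.1; omega, ih.2.trans h.2⟩

theorem VReach.coord {C : GridCovering.{u}} {x y : C.V} (h : C.VReach x y) :
    (C.γ x).1 = (C.γ y).1 ∧ ((C.γ x).2 : ℕ) ≤ ((C.γ y).2 : ℕ) := by
  induction h with
  | refl => exact ⟨rfl, le_rfl⟩
  | tail _ h ih => exact ⟨ih.1.trans h.2, by have := h.coord.2; omega⟩

/-- Left and right sails meet only in diagonal vertices. -/
theorem left_right_diag {p : C.V × C.V} (hl : C.IsLeft p) (hr : C.IsRight p) : p.1 = p.2 := by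
  rcases Relation.ReflTransGen.cases_head hl with h | ⟨z, hz, hz'⟩
  · exact h
  · have h1 := hz.coord.1
    have h2 := (HReach.coord hz').1
    have h3 := congrArg Fin.val (VReach.coord hr).1
    omega

/-- Over a path `q_0 → ⋯ → q_a` of `G` mapped to some `(P_a, ·)`, the vertices `(q_i, q_j)`,
`i ≤ j`, of `sailGraph` form a copy of the left sail of size `a` with diagonal `q_0, …, q_a`. -/
theorem leftSail_copy (q : Fin (C.a + 1) → C.V)
    (hq : ∀ s t : Fin (C.a + 1), (s : ℕ) + 1 = (t : ℕ) → C.HEdge (q s) (q t)) :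
    (∀ s t, C.IsLeft (q s, q t) ↔ s ≤ t) ∧
    ∃ f : (leftSail C.a).V → C.sailGraph.V, (∀ p, (f p).1 = (q p.1.1, q p.1.2)) ∧
      Function.Injective f ∧
      ∀ i p p', C.sailGraph.E i (f p) (f p') ↔ (leftSail C.a).E i p p' := by
  have co : ∀ n (hn : n < C.a + 1), ((C.γ (q ⟨n, hn⟩)).1 : ℕ) = n := by
    have lo : ∀ n (hn : n < C.a + 1),
        ((C.γ (q ⟨n, hn⟩)).1 : ℕ) = ((C.γ (q 0)).1 : ℕ) + n := by
      intro n
      induction n with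
      | zero => intro _; rfl
      | succ n ih =>
        intro hn
        have := (hq ⟨n, by omega⟩ ⟨n + 1, hn⟩ rfl).coord.1
        have := ih (by omega)
        omega
    intro n hn
    have h1 := lo C.a (by omega)
    have h2 := (C.γ (q ⟨C.a, by omega⟩)).1.isLt
    have h3 := lo n hn
    omega
  have co' : ∀ s : Fin (C.a + 1), ((C.γ (q s)).1 : ℕ) = s := fun s => co s.1 s.2
  have inj : Function.Injective q := fun s t h => by
    apply Fin.ext; rw [← co' s, ← co' t, h]
  have reach : ∀ s t, C.IsLeft (q s, q t) ↔ s ≤ t := by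
    intro s t
    constructor
    · intro h
      have := (HReach.coord h).1
      simp only [co'] at this
      exact this
    · have : ∀ n (hn : n < C.a + 1), (s : ℕ) ≤ n → C.IsLeft (q s, q ⟨n, hn⟩) := by
        intro n
        induction n with
        | zero =>
          intro hn h
          have : s = ⟨0, hn⟩ := Fin.ext (by simpa using h)
          subst this
          exact Relation.ReflTransGen.refl
        | succ n ih =>
          intro hn h
          rcases Nat.lt_or_ge n s with h' | h'
          · have : s = ⟨n + 1, hn⟩ := Fin.ext (by simp; omega)
            subst this
            exact Relation.ReflTransGen.refl
          · exact Relation.ReflTransGen.tail (ih (by omega) h') (hq ⟨n, by omega⟩ ⟨n + 1, hn⟩ rfl)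
      exact fun h => this t.1 t.2 h
  have edge : ∀ s t, C.HEdge (q s) (q t) ↔ (s : ℕ) + 1 = t := fun s t =>
    ⟨fun h => by have := h.coord.1; simpa only [co'] using this, hq s t⟩
  have nov : ∀ s t, ¬ C.VEdge (q s) (q t) := fun s t h => by
    have h1 := congrArg Fin.val h.coord.1
    rw [co', co'] at h1
    have h2 := h.coord.2
    rw [Fin.ext h1] at h2
    omega
  refine ⟨reach, fun p => ⟨(q p.1.1, q p.1.2), Or.inl ((reach _ _).2 p.2)⟩, fun _ => rfl, ?_, ?_⟩
  · intro p p' h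
    have h' := congrArg Subtype.val h
    simp only [Prod.mk.injEq] at h'
    exact Subtype.ext (Prod.ext (inj h'.1) (inj h'.2))
  · rintro (_ | _) p p'
    · simp only [sailGraph, leftSail, edge, nov, reach, p.2, p'.2, inj.eq_iff]
      tauto
    · simp only [sailGraph, leftSail, edge, nov, reach, p.2, p'.2, inj.eq_iff]
      tauto

/-- Over a path `q_0 → ⋯ → q_b` of `G` mapped to some `(·, P_b)`, the vertices `(q_i, q_j)`,
`j ≤ i`, of `sailGraph` form a copy of the right sail of size `b` with diagonal `q_0, …, q_b`. -/
theorem rightSail_copy (q : Fin (C.b + 1) → C.V)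
    (hq : ∀ s t : Fin (C.b + 1), (s : ℕ) + 1 = (t : ℕ) → C.VEdge (q s) (q t)) :
    (∀ s t, C.IsRight (q s, q t) ↔ t ≤ s) ∧
    ∃ f : (rightSail C.b).V → C.sailGraph.V, (∀ p, (f p).1 = (q p.1.1, q p.1.2)) ∧
      Function.Injective f ∧
      ∀ i p p', C.sailGraph.E i (f p) (f p') ↔ (rightSail C.b).E i p p' := by
  have co : ∀ n (hn : n < C.b + 1), ((C.γ (q ⟨n, hn⟩)).2 : ℕ) = n := by
    have lo : ∀ n (hn : n < C.b + 1),
        ((C.γ (q ⟨n, hn⟩)).2 : ℕ) = ((C.γ (q 0)).2 : ℕ) + n := by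
      intro n
      induction n with
      | zero => intro _; rfl
      | succ n ih =>
        intro hn
        have := (hq ⟨n, by omega⟩ ⟨n + 1, hn⟩ rfl).coord.2
        have := ih (by omega)
        omega
    intro n hn
    have h1 := lo C.b (by omega)
    have h2 := (C.γ (q ⟨C.b, by omega⟩)).2.isLt
    have h3 := lo n hn
    omega
  have co' : ∀ s : Fin (C.b + 1), ((C.γ (q s)).2 : ℕ) = s := fun s => co s.1 s.2
  have inj : Function.Injective q := fun s t h => by
    apply Fin.ext; rw [← co' s, ← co' t, h]
  have reach : ∀ s t, C.IsRight (q s, q t) ↔ t ≤ s := by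
    intro s t
    constructor
    · intro h
      have := (VReach.coord h).2
      simp only [co'] at this
      exact this
    · have : ∀ n (hn : n < C.b + 1), (t : ℕ) ≤ n → C.IsRight (q ⟨n, hn⟩, q t) := by
        intro n
        induction n with
        | zero =>
          intro hn h
          have : t = ⟨0, hn⟩ := Fin.ext (by simpa using h)
          subst this
          exact Relation.ReflTransGen.refl
        | succ n ih =>
          intro hn h
          rcases Nat.lt_or_ge n t with h' | h'
          · have : t = ⟨n + 1, hn⟩ := Fin.ext (by simp; omega)
            subst this
            exact Relation.ReflTransGen.refl
          · exact Relation.ReflTransGen.tail (ih (by omega) h') (hq ⟨n, by omega⟩ ⟨n + 1, hn⟩ rfl)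
      exact fun h => this s.1 s.2 h
  have edge : ∀ s t, C.VEdge (q s) (q t) ↔ (s : ℕ) + 1 = t := fun s t =>
    ⟨fun h => by have := h.coord.2; simpa only [co'] using this, hq s t⟩
  have noh : ∀ s t, ¬ C.HEdge (q s) (q t) := fun s t h => by
    have h1 := congrArg Fin.val h.coord.2
    rw [co', co'] at h1
    have h2 := h.coord.1
    rw [Fin.ext h1] at h2
    omega
  refine ⟨reach, fun p => ⟨(q p.1.1, q p.1.2), Or.inr ((reach _ _).2 p.2)⟩, fun _ => rfl, ?_, ?_⟩
  · intro p p' h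
    have h' := congrArg Subtype.val h
    simp only [Prod.mk.injEq] at h'
    exact Subtype.ext (Prod.ext (inj h'.1) (inj h'.2))
  · rintro (_ | _) p p'
    · simp only [sailGraph, rightSail, edge, noh, reach, p.2, p'.2, inj.eq_iff]
      tauto
    · simp only [sailGraph, rightSail, edge, noh, reach, p.2, p'.2, inj.eq_iff]
      tauto

end GridCovering

/-! By (A2) the labels along a line are first 0, then 1, and the change takes place at a critical
vertex. The proof shows that critical vertices are the vertices of the covering, and that everything
else is determined by them.

From a covering to a WC-graph: in a sail of colour `i` (left for colour 1, right for colour 2) the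
`i`-edges run towards the diagonal and have label 0, while the edges of the other colour run away
from it and have label 1. A line crosses a sail of its own colour up to the diagonal and continues
in a sail of the other colour. This gives closed formulas for `t` and `h`, from which the axioms
follow (`GridSystem.sails_data`).

Injectivity: the critical vertices of a sail graph are exactly the diagonal ones (`crit_iff`). There
`t` gives the grid coordinates, `t` and `h` together give the sizes of the grid (`t_diag`,
`h_diag`), and an edge of the covering is a two-edge path between diagonal vertices (`edge_diag`).
So an isomorphism of sail graphs restricts to one of coverings (`exists_equiv_of_sails`).

Surjectivity: in a WC-graph, (A3) makes a vertex that is critical on one of its lines critical on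
the other (`LineCrit.crit`). Join critical `x` to critical `y` in direction `i` if an `i.other`-edge
of label 1 followed by an `i`-edge of label 0 leads from `x` to `y`. The commuting squares of (A3)
show that each vertex has a unique position `(x, y)` in a sail over this relation (`Pos`, `Spec`),
so the graph is the union of these sails (`isomorphic_sails`). Since `t i + h i.other` is constant
on critical vertices, they form a covering over a grid (`WCData.gridSystem`,
`GridSystem.exists_covering`). -/

namespace Color

@[simp] theorem other_other (i : Color) : i.other.other = i := by cases i <;> rfl

theorem eq_or_eq_other (i k : Color) : k = i ∨ k = i.other := by
  cases i <;> cases k <;> simp [other]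

end Color

theorem eqvGen_of_reflTransGen {V : Type*} {r s : V → V → Prop} (hrs : ∀ x y, r x y → s x y)
    {x y : V} (hxy : Relation.ReflTransGen r x y) : Relation.EqvGen s x y := by
  induction hxy with
  | refl => exact Relation.EqvGen.refl _
  | tail _ h ih => exact ih.trans _ _ _ (Relation.EqvGen.rel _ _ (hrs _ _ h))

/-! ### Lines, and a local form of the axioms -/

namespace TwoColoredDigraph

variable {K : TwoColoredDigraph.{u}}

section Path

variable {i : Color} {k : ℕ} {p : Fin (k + 1) → K.V}

theorem reach_of_path (hE : ∀ s t : Fin (k + 1), K.E i (p s) (p t) ↔ (s : ℕ) + 1 = (t : ℕ))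
    {s t : Fin (k + 1)} (hst : s ≤ t) : K.Reach i (p s) (p t) := by
  obtain ⟨t, ht⟩ := t
  induction t with
  | zero =>
    have : s = ⟨0, ht⟩ := Fin.ext (by simpa using hst)
    subst this
    exact Relation.ReflTransGen.refl
  | succ n ih =>
    rcases Nat.lt_or_ge n s with h | h
    · have : s = ⟨n + 1, ht⟩ := le_antisymm hst (by simpa [Fin.le_def] using h)
      subst this
      exact Relation.ReflTransGen.refl
    · exact (ih (by omega) (by simpa [Fin.le_def] using h)).tail ((hE _ _).2 rfl)

theorem transGen_of_path (hE : ∀ s t : Fin (k + 1), K.E i (p s) (p t) ↔ (s : ℕ) + 1 = (t : ℕ))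
    {s t : Fin (k + 1)} (hst : s < t) : Relation.TransGen (K.E i) (p s) (p t) := by
  have h : (s : ℕ) + 1 < k + 1 := by have := t.isLt; rw [Fin.lt_def] at hst; omega
  exact Relation.TransGen.head' ((hE s ⟨s + 1, h⟩).2 rfl)
    (reach_of_path hE (by rw [Fin.lt_def] at hst; rw [Fin.le_def]; exact hst))

/-- Along an enumeration of a whole `i`-line, `t_i` and `h_i` are given by the index. -/
theorem t_h_of_path (inj : Function.Injective p)
    (hE : ∀ s t : Fin (k + 1), K.E i (p s) (p t) ↔ (s : ℕ) + 1 = (t : ℕ))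
    (hout : ∀ s w, K.E i (p s) w → w ∈ Set.range p)
    (hin : ∀ s w, K.E i w (p s) → w ∈ Set.range p) (s : Fin (k + 1)) :
    K.t i (p s) = s ∧ K.h i (p s) = k - s := by
  constructor
  · have : {w : K.V | Relation.TransGen (K.E i) w (p s)} = p '' Set.Iio s := by
      ext w
      constructor
      · intro hw
        induction hw using Relation.TransGen.head_induction_on with
        | single h =>
          obtain ⟨n, rfl⟩ := hin s _ h
          have := (hE _ _).1 h
          exact ⟨n, by rw [Set.mem_Iio, Fin.lt_def]; omega, rfl⟩
        | head h _ ih =>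
          obtain ⟨m, hm, rfl⟩ := ih
          obtain ⟨n, rfl⟩ := hin m _ h
          have := (hE _ _).1 h
          rw [Set.mem_Iio, Fin.lt_def] at hm
          exact ⟨n, by rw [Set.mem_Iio, Fin.lt_def]; omega, rfl⟩
      · rintro ⟨n, hn, rfl⟩
        exact transGen_of_path hE hn
    rw [t, this, Set.ncard_image_of_injective _ inj, Set.ncard_eq_toFinset_card']
    simp
  · have : {w : K.V | Relation.TransGen (K.E i) (p s) w} = p '' Set.Ioi s := by
      ext w
      constructor
      · intro hw
        change Relation.TransGen (K.E i) (p s) w at hw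
        induction hw with
        | single h =>
          obtain ⟨n, rfl⟩ := hout s _ h
          have := (hE _ _).1 h
          exact ⟨n, by rw [Set.mem_Ioi, Fin.lt_def]; omega, rfl⟩
        | tail _ h ih =>
          obtain ⟨m, hm, rfl⟩ := ih
          obtain ⟨n, rfl⟩ := hout m _ h
          have := (hE _ _).1 h
          rw [Set.mem_Ioi, Fin.lt_def] at hm
          exact ⟨n, by rw [Set.mem_Ioi, Fin.lt_def]; omega, rfl⟩
      · rintro ⟨n, hn, rfl⟩
        exact transGen_of_path hE hn
    rw [h, this, Set.ncard_image_of_injective _ inj, Set.ncard_eq_toFinset_card']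
    simp

end Path

/-- A local form of the axioms (A1), (A2), (A3), for given functions `t` and `h`. -/
structure WCData (K : TwoColoredDigraph.{u}) (t h : Color → K.V → ℕ) : Prop where
  out_unique : ∀ {i u v v'}, K.E i u v → K.E i u v' → v = v'
  in_unique : ∀ {i u u' v}, K.E i u v → K.E i u' v → u = u'
  t_succ : ∀ {i u v}, K.E i u v → t i v = t i u + 1
  h_succ : ∀ {i u v}, K.E i u v → h i u = h i v + 1
  exists_in : ∀ {i v}, 0 < t i v → ∃ u, K.E i u v
  exists_out : ∀ {i v}, 0 < h i v → ∃ w, K.E i v w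
  label_cases : ∀ {i u v}, K.E i u v →
    (t i.other u = t i.other v + 1 ∧ h i.other v = h i.other u) ∨
      (t i.other v = t i.other u ∧ h i.other v = h i.other u + 1)
  label_mono : ∀ {i u v w}, K.E i u v → K.E i v w → h i.other v = h i.other u + 1 →
    h i.other w = h i.other v + 1
  square_out : ∀ {i u v v'}, K.E i u v → K.E i.other u v' → h i.other v = h i.other u →
    h i v' = h i u + 1 ∧ ∃ w, K.E i.other v w ∧ K.E i v' w
  square_in : ∀ {i v u u'}, K.E i u v → K.E i.other u' v → h i.other v = h i.other u + 1 →
    h i v = h i u' ∧ ∃ w, K.E i.other w u ∧ K.E i w u'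

/-- A whole `i`-line through each vertex, from (A1). -/
theorem A1.exists_path (hK : K.A1) (i : Color) (v : K.V) :
    ∃ (k : ℕ) (p : Fin (k + 1) → K.V) (s : Fin (k + 1)), p s = v ∧
      (∀ w, K.SameLine i v w → w ∈ Set.range p) ∧
      (∀ s t : Fin (k + 1), K.E i (p s) (p t) ↔ (s : ℕ) + 1 = (t : ℕ)) ∧
      (∀ s w, K.E i (p s) w → w ∈ Set.range p) ∧
      (∀ s w, K.E i w (p s) → w ∈ Set.range p) ∧
      (∀ s, K.t i (p s) = s ∧ K.h i (p s) = k - s) := by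
  obtain ⟨k, p, inj, hr, hE⟩ := hK i v
  have hv : v ∈ Set.range p := by rw [hr]; exact Relation.EqvGen.refl v
  obtain ⟨s, hs⟩ := hv
  have mem : ∀ s, K.SameLine i v (p s) := fun s => by
    have : p s ∈ Set.range p := ⟨s, rfl⟩
    rwa [hr] at this
  have hout : ∀ s w, K.E i (p s) w → w ∈ Set.range p := fun s w h => by
    rw [hr]; exact (mem s).trans _ _ _ (Relation.EqvGen.rel _ _ h)
  have hin : ∀ s w, K.E i w (p s) → w ∈ Set.range p := fun s w h => by
    rw [hr]; exact (mem s).trans _ _ _ (Relation.EqvGen.rel _ _ h).symm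
  exact ⟨k, p, s, hs, fun w hw => by rw [hr]; exact hw, hE, hout, hin, t_h_of_path inj hE hout hin⟩

theorem A1.reach_or_reach (hK : K.A1) {i : Color} {u v r : K.V} (huv : K.E i u v)
    (hr : K.SameLine i u r) : K.Reach i v r ∨ K.Reach i r u := by
  obtain ⟨k, p, s, rfl, hl, hE, hout, -⟩ := hK.exists_path i u
  obtain ⟨c, rfl⟩ := hl r hr
  obtain ⟨d, rfl⟩ := hout _ _ huv
  have := (hE _ _).1 huv
  rcases le_or_gt c s with h | h
  · exact Or.inr (reach_of_path hE h)
  · refine Or.inl (reach_of_path hE ?_)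
    rw [Fin.lt_def] at h
    rw [Fin.le_def]
    omega

/-- Everything is read off an enumeration of a line, except `label_mono`, which is the content of
(A2) that is not local to one edge. -/
theorem IsWC.data (hK : K.IsWC) : WCData K K.t K.h := by
  obtain ⟨-, h1, h2, h3⟩ := hK
  have t_succ : ∀ {i u v}, K.E i u v → K.t i v = K.t i u + 1 ∧ K.h i u = K.h i v + 1 := by
    intro i u v h
    obtain ⟨k, p, s, rfl, -, hE, hout, -, hth⟩ := h1.exists_path i u
    obtain ⟨d, rfl⟩ := hout _ _ h
    have := (hE _ _).1 h
    have := hth s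
    have := hth d
    have := d.isLt
    omega
  have cases : ∀ {i u r v}, K.E i u v → K.SameLine i u r → K.Reach i v r ∨ K.Reach i r u :=
    fun h hr => h1.reach_or_reach h hr
  have lab : ∀ {i u v}, K.E i u v → ∃ r, K.SameLine i u r ∧
      ((K.Reach i v r ∧ K.t i.other u = K.t i.other v + 1 ∧ K.h i.other v = K.h i.other u) ∨
      (K.Reach i r u ∧ K.t i.other v = K.t i.other u ∧ K.h i.other v = K.h i.other u + 1)) := by
    intro i u v h
    obtain ⟨r, hr, ha, hb⟩ := h2 i u
    rcases cases h hr with h' | h'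
    · exact ⟨r, hr, Or.inl ⟨h', ha u v h h'⟩⟩
    · exact ⟨r, hr, Or.inr ⟨h', hb u v h h'⟩⟩
  have label_cases : ∀ {i u v}, K.E i u v →
    (K.t i.other u = K.t i.other v + 1 ∧ K.h i.other v = K.h i.other u) ∨
      (K.t i.other v = K.t i.other u ∧ K.h i.other v = K.h i.other u + 1) := by
    intro i u v h
    obtain ⟨r, -, h | h⟩ := lab h
    · exact Or.inl h.2
    · exact Or.inr h.2
  have label_one : ∀ {i u v}, K.E i u v → (K.label i u v = 1 ↔ K.h i.other v = K.h i.other u + 1) := by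
    intro i u v h
    have := label_cases h
    unfold label
    split_ifs <;> simp <;> omega
  have label_zero : ∀ {i u v}, K.label i u v = 0 ↔ K.h i.other v = K.h i.other u := by
    intro i u v
    unfold label
    split_ifs <;> simp <;> omega
  refine ⟨?_, ?_, fun h => (t_succ h).1, fun h => (t_succ h).2, ?_, ?_, label_cases, ?_, ?_, ?_⟩
  · intro i u v v' h h'
    obtain ⟨k, p, s, rfl, -, hE, hout, -, hth⟩ := h1.exists_path i u
    obtain ⟨d, rfl⟩ := hout _ _ h
    obtain ⟨d', rfl⟩ := hout _ _ h'
    have := (hE _ _).1 h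
    have := (hE _ _).1 h'
    congr 1
    apply Fin.ext; omega
  · intro i u u' v h h'
    obtain ⟨k, p, s, rfl, -, hE, -, hin, hth⟩ := h1.exists_path i v
    obtain ⟨d, rfl⟩ := hin _ _ h
    obtain ⟨d', rfl⟩ := hin _ _ h'
    have := (hE _ _).1 h
    have := (hE _ _).1 h'
    congr 1
    apply Fin.ext; omega
  · intro i v h
    obtain ⟨k, p, s, rfl, -, hE, -, hin, hth⟩ := h1.exists_path i v
    have := hth s
    exact ⟨p ⟨s - 1, by omega⟩, (hE _ _).2 (by simp only; omega)⟩
  · intro i v h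
    obtain ⟨k, p, s, rfl, -, hE, -, hin, hth⟩ := h1.exists_path i v
    have := hth s
    exact ⟨p ⟨s + 1, by omega⟩, (hE _ _).2 (by simp only)⟩
  · intro i u v w h h' hl
    -- An edge of label 1 cannot lie before `r`, so the next edge lies after `r` as well.
    obtain ⟨r, hr, ha, hb⟩ := h2 i u
    rcases cases h hr with hc | hc
    · have := ha u v h hc; omega
    · exact (hb v w h' (hc.tail h)).2
  · intro i u v v' h h' hl
    have := h3.1 i u v v' h h' (label_zero.2 hl)
    rw [label_one h', Color.other_other] at this
    exact this
  · intro i v u u' h h' hl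
    have := h3.2 i v u u' h h' ((label_one h).2 hl)
    rw [label_zero, Color.other_other] at this
    exact this

namespace WCData

variable {t h : Color → K.V → ℕ}

theorem exists_first (D : WCData K t h) (i : Color) (v : K.V) :
    ∃ w, t i w = 0 ∧ K.Reach i w v := by
  induction hn : t i v generalizing v with
  | zero => exact ⟨v, hn, Relation.ReflTransGen.refl⟩
  | succ n ih =>
    obtain ⟨u, hu⟩ := D.exists_in (i := i) (v := v) (by omega)
    obtain ⟨w, hw, hw'⟩ := ih u (by have := D.t_succ hu; omega)
    exact ⟨w, hw, hw'.tail hu⟩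

/-- The functions `t` and `h` are not assumed to be the true distances. Since they change by one
along edges and edges exist where they are positive, iterating the successor `h i w` times from a
vertex `w` with `t i w = 0` runs through the whole line, which forces them to be the distances
(`t_eq`, `h_eq`). -/
theorem exists_path (D : WCData K t h) (i : Color) (v : K.V) :
    ∃ (k : ℕ) (p : Fin (k + 1) → K.V) (s : Fin (k + 1)), p s = v ∧ Function.Injective p ∧
      (∀ s t : Fin (k + 1), K.E i (p s) (p t) ↔ (s : ℕ) + 1 = (t : ℕ)) ∧
      (∀ s w, K.E i (p s) w → w ∈ Set.range p) ∧
      (∀ s w, K.E i w (p s) → w ∈ Set.range p) ∧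
      (∀ s, t i (p s) = s ∧ h i (p s) = k - s) := by
  classical
  obtain ⟨w, hw, hwv⟩ := D.exists_first i v
  -- The default value `x` is used only at the end of a line, beyond which the path is not
  -- continued.
  let F : K.V → K.V := fun x => if hx : ∃ y, K.E i x y then hx.choose else x
  have hF : ∀ x, 0 < h i x → K.E i x (F x) := by
    intro x hx
    have := D.exists_out hx
    simp only [F, dif_pos this]
    exact this.choose_spec
  have co : ∀ n, n ≤ h i w → t i (F^[n] w) = n ∧ h i (F^[n] w) + n = h i w := by
    intro n
    induction n with
    | zero => intro _; exact ⟨hw, rfl⟩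
    | succ n ih =>
      intro hn
      have h1 := ih (by omega)
      have h2 := hF (F^[n] w) (by omega)
      rw [Function.iterate_succ_apply']
      have := D.t_succ h2
      have := D.h_succ h2
      omega
  have co' : ∀ s : Fin (h i w + 1), t i (F^[s] w) = s ∧ h i (F^[s] w) = h i w - s := by
    intro s
    have := co s (by have := s.isLt; omega)
    omega
  have hE : ∀ s s' : Fin (h i w + 1), K.E i (F^[s] w) (F^[s'] w) ↔ (s : ℕ) + 1 = (s' : ℕ) := by
    intro s s'
    constructor
    · intro he
      have := D.t_succ he
      have := (co' s).1
      have := (co' s').1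
      omega
    · intro he
      rw [← he, Function.iterate_succ_apply']
      apply hF
      have := (co' s).2
      have := s'.isLt
      omega
  have hout : ∀ (s : Fin (h i w + 1)) x, K.E i (F^[s] w) x →
      x ∈ Set.range (fun s : Fin (h i w + 1) => F^[s] w) := by
    intro s x hx
    have h1 := D.h_succ hx
    have h2 := (co' s).2
    have h3 : (s : ℕ) + 1 < h i w + 1 := by omega
    exact ⟨⟨s + 1, h3⟩, D.out_unique ((hE s ⟨s + 1, h3⟩).2 rfl) hx⟩
  have hin : ∀ (s : Fin (h i w + 1)) x, K.E i x (F^[s] w) →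
      x ∈ Set.range (fun s : Fin (h i w + 1) => F^[s] w) := by
    intro s x hx
    have h1 := D.t_succ hx
    have h2 := (co' s).1
    have h3 : (s : ℕ) - 1 < h i w + 1 := by omega
    exact ⟨⟨s - 1, h3⟩, D.in_unique ((hE ⟨s - 1, h3⟩ s).2 (by simp only; omega)) hx⟩
  have hv : v ∈ Set.range (fun s : Fin (h i w + 1) => F^[s] w) := by
    clear hw
    change Relation.ReflTransGen (K.E i) w v at hwv
    induction hwv with
    | refl => exact ⟨0, rfl⟩
    | tail _ he ih =>
      obtain ⟨s, rfl⟩ := ih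
      exact hout s _ he
  obtain ⟨s, hs⟩ := hv
  refine ⟨h i w, fun s => F^[s] w, s, hs, ?_, hE, hout, hin, co'⟩
  intro s s' hss
  have h1 := (co' s).1
  have h2 := (co' s').1
  simp only at hss
  rw [hss] at h1
  exact Fin.ext (h1.symm.trans h2)

theorem A1 (D : WCData K t h) : K.A1 := by
  intro i v
  obtain ⟨k, p, s, rfl, inj, hE, hout, hin, -⟩ := D.exists_path i v
  refine ⟨k, p, inj, ?_, hE⟩
  apply Set.Subset.antisymm
  · rintro _ ⟨s', rfl⟩
    rcases le_total s s' with h' | h'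
    · exact eqvGen_of_reflTransGen (fun _ _ h => h) (reach_of_path hE h')
    · exact (eqvGen_of_reflTransGen (fun _ _ h => h) (reach_of_path hE h')).symm
  · intro w hw
    have key : ∀ x y, Relation.EqvGen (K.E i) x y → (x ∈ Set.range p ↔ y ∈ Set.range p) := by
      intro x y hxy
      induction hxy with
      | rel x y hxy =>
        constructor
        · rintro ⟨n, rfl⟩; exact hout n _ hxy
        · rintro ⟨n, rfl⟩; exact hin n _ hxy
      | refl => rfl
      | symm _ _ _ ih => exact ih.symm
      | trans _ _ _ _ _ ih ih' => exact ih.trans ih'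
    exact (key _ _ hw).1 ⟨s, rfl⟩

theorem t_eq (D : WCData K t h) (i : Color) (v : K.V) : K.t i v = t i v := by
  obtain ⟨k, p, s, rfl, inj, hE, hout, hin, hth⟩ := D.exists_path i v
  rw [(t_h_of_path inj hE hout hin s).1, (hth s).1]

theorem h_eq (D : WCData K t h) (i : Color) (v : K.V) : K.h i v = h i v := by
  obtain ⟨k, p, s, rfl, inj, hE, hout, hin, hth⟩ := D.exists_path i v
  rw [(t_h_of_path inj hE hout hin s).2, (hth s).2]

/-- Edges with label 0. -/
def Zero (h : Color → K.V → ℕ) (i : Color) (u v : K.V) : Prop :=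
  K.E i u v ∧ h i.other v = h i.other u

/-- Edges with label 1. -/
def One (h : Color → K.V → ℕ) (i : Color) (u v : K.V) : Prop :=
  K.E i u v ∧ h i.other v = h i.other u + 1

theorem zero_or_one (D : WCData K t h) {i : Color} {u v : K.V} (he : K.E i u v) :
    Zero h i u v ∨ One h i u v :=
  (D.label_cases he).imp (fun h => ⟨he, h.2⟩) (fun h => ⟨he, h.2⟩)

theorem zero_coord (D : WCData K t h) {i : Color} {u v : K.V} (he : Zero h i u v) :
    t i v = t i u + 1 ∧ h i u = h i v + 1 ∧ t i.other u = t i.other v + 1 ∧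
      h i.other v = h i.other u := by
  have := D.label_cases he.1
  have := he.2
  exact ⟨D.t_succ he.1, D.h_succ he.1, by omega, by omega⟩

theorem one_coord (D : WCData K t h) {i : Color} {u v : K.V} (he : One h i u v) :
    t i v = t i u + 1 ∧ h i u = h i v + 1 ∧ t i.other v = t i.other u ∧
      h i.other v = h i.other u + 1 := by
  have := D.label_cases he.1
  have := he.2
  exact ⟨D.t_succ he.1, D.h_succ he.1, by omega, by omega⟩

/-- The critical vertex of an `i`-line: it is entered by label 0 and left by label 1. -/
def LineCrit (h : Color → K.V → ℕ) (i : Color) (v : K.V) : Prop :=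
  (∀ u, ¬ One h i u v) ∧ ∀ w, ¬ Zero h i v w

theorem exists_lineCrit_of_zero (D : WCData K t h) {i : Color} {v w : K.V} (he : Zero h i v w) :
    ∃ r, LineCrit h i r ∧ Relation.ReflTransGen (Zero h i) w r := by
  induction hn : h i w generalizing v w with
  | zero =>
    refine ⟨w, ⟨fun u hu => ?_, fun x hx => ?_⟩, Relation.ReflTransGen.refl⟩
    · obtain rfl := D.in_unique he.1 hu.1
      have := he.2
      have := hu.2
      omega
    · have := D.h_succ hx.1
      omega
  | succ n ih =>
    by_cases hx : ∃ x, Zero h i w x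
    · obtain ⟨x, hx⟩ := hx
      obtain ⟨r, hr, hr'⟩ := ih hx (by have := D.h_succ hx.1; omega)
      exact ⟨r, hr, hr'.head hx⟩
    · refine ⟨w, ⟨fun u hu => ?_, fun x hx' => hx ⟨x, hx'⟩⟩, Relation.ReflTransGen.refl⟩
      obtain rfl := D.in_unique he.1 hu.1
      have := he.2
      have := hu.2
      omega

theorem exists_lineCrit_of_one (D : WCData K t h) {i : Color} {v w : K.V} (he : One h i w v) :
    ∃ r, LineCrit h i r ∧ Relation.ReflTransGen (One h i) r w := by
  induction hn : t i w generalizing v w with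
  | zero =>
    refine ⟨w, ⟨fun u hu => ?_, fun x hx => ?_⟩, Relation.ReflTransGen.refl⟩
    · have := D.t_succ hu.1
      omega
    · obtain rfl := D.out_unique he.1 hx.1
      have := he.2
      have := hx.2
      omega
  | succ n ih =>
    by_cases hx : ∃ x, One h i x w
    · obtain ⟨x, hx⟩ := hx
      obtain ⟨r, hr, hr'⟩ := ih hx (by have := D.t_succ hx.1; omega)
      exact ⟨r, hr, hr'.tail hx⟩
    · refine ⟨w, ⟨fun x hx' => hx ⟨x, hx'⟩, fun u hu => ?_⟩, Relation.ReflTransGen.refl⟩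
      obtain rfl := D.out_unique he.1 hu.1
      have := he.2
      have := hu.2
      omega

theorem exists_lineCrit (D : WCData K t h) (i : Color) (v : K.V) :
    ∃ r, LineCrit h i r ∧
      (Relation.ReflTransGen (Zero h i) v r ∨ Relation.ReflTransGen (One h i) r v) := by
  by_cases hx : ∃ x, Zero h i v x
  · obtain ⟨x, hx⟩ := hx
    obtain ⟨r, hr, hr'⟩ := D.exists_lineCrit_of_zero hx
    exact ⟨r, hr, Or.inl (hr'.head hx)⟩
  by_cases hy : ∃ x, One h i x v
  · obtain ⟨x, hy⟩ := hy
    obtain ⟨r, hr, hr'⟩ := D.exists_lineCrit_of_one hy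
    exact ⟨r, hr, Or.inr (hr'.tail hy)⟩
  exact ⟨v, ⟨fun u hu => hy ⟨u, hu⟩, fun u hu => hx ⟨u, hu⟩⟩, Or.inl Relation.ReflTransGen.refl⟩

/-- By `label_mono` no 1 is followed by a 0 on a line. Hence a label 1 before `r` would make an edge
of label 1 enter `r`, and a label 0 after `r` would make an edge of label 0 leave it; `LineCrit`
forbids both. -/
theorem A2 (D : WCData K t h) : K.A2 := by
  intro i x
  obtain ⟨r, hr, hxr⟩ := D.exists_lineCrit i x
  refine ⟨r, ?_, ?_, ?_⟩
  · rcases hxr with hx | hx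
    · exact eqvGen_of_reflTransGen (fun _ _ h => h.1) hx
    · exact (eqvGen_of_reflTransGen (fun _ _ h => h.1) hx).symm
  · intro u v he hv
    rcases D.label_cases he with h1 | h1
    · simpa only [D.t_eq, D.h_eq] using h1
    · exfalso
      have h2 : ∃ u, One h i u r := by
        change Relation.ReflTransGen (K.E i) v r at hv
        have ho : ∃ u, One h i u v := ⟨u, he, h1.2⟩
        clear he h1 hr hxr
        induction hv with
        | refl => exact ho
        | tail _ he ih =>
          obtain ⟨u, hu⟩ := ih
          exact ⟨_, he, D.label_mono hu.1 he hu.2⟩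
      obtain ⟨u, hu⟩ := h2
      exact hr.1 u hu
  · intro u v he hv
    rcases D.label_cases he with h1 | h1
    · exfalso
      have h2 : ∃ u, Zero h i r u := by
        have ho : ∃ v, Zero h i u v := ⟨v, he, h1.2⟩
        clear he h1 hr hxr
        induction hv using Relation.ReflTransGen.head_induction_on with
        | refl => exact ho
        | head he _ ih =>
          obtain ⟨u, hu⟩ := ih
          refine ⟨_, he, ?_⟩
          rcases D.label_cases he with h1 | h1
          · exact h1.2
          · have := D.label_mono he hu.1 h1.2
            have := hu.2
            omega
      obtain ⟨u, hu⟩ := h2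
      exact hr.2 u hu
    · simpa only [D.t_eq, D.h_eq] using h1

theorem A3 (D : WCData K t h) : K.A3 := by
  have label_zero : ∀ {i u v}, K.label i u v = 0 ↔ h i.other v = h i.other u := by
    intro i u v
    unfold label
    rw [D.h_eq, D.h_eq]
    split_ifs <;> simp <;> omega
  have label_one : ∀ {i u v}, K.E i u v → (K.label i u v = 1 ↔ h i.other v = h i.other u + 1) := by
    intro i u v he
    have := D.label_cases he
    unfold label
    rw [D.h_eq, D.h_eq]
    split_ifs <;> simp <;> omega
  constructor
  · intro i u v v' he he' hl
    rw [label_one he', Color.other_other]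
    exact D.square_out he he' (label_zero.1 hl)
  · intro i u v v' he he' hl
    rw [label_zero, Color.other_other]
    exact D.square_in he he' ((label_one he).1 hl)

theorem isWC (D : WCData K t h) (hK : K.Connected) : K.IsWC := ⟨hK, D.A1, D.A2, D.A3⟩

end WCData

end TwoColoredDigraph

/-! ### Sails over an abstract grid-like relation form a WC-graph -/

/-- The projection of a sail vertex to the path position that is fixed by the `i`-edges. -/
def Color.proj {V : Type u} : Color → V × V → V
  | .one => Prod.snd
  | .two => Prod.fst

theorem Color.proj_ext {V : Type u} (i : Color) {p q : V × V} (h : i.proj p = i.proj q)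
    (h' : i.other.proj p = i.other.proj q) : p = q := by
  cases i
  · exact Prod.ext h' h
  · exact Prod.ext h h'

/-- The pair with prescribed projections. -/
def Color.pair {V : Type u} : Color → V → V → V × V
  | .one => fun x y => (y, x)
  | .two => fun x y => (x, y)

@[simp] theorem Color.proj_pair {V : Type u} (i : Color) (x y : V) : i.proj (i.pair x y) = x := by
  cases i <;> rfl

@[simp] theorem Color.proj_other_pair {V : Type u} (i : Color) (x y : V) :
    i.other.proj (i.pair x y) = y := by
  cases i <;> rfl

@[simp] theorem Color.proj_diag {V : Type u} (i : Color) (x : V) : i.proj (x, x) = x := by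
  cases i <;> rfl

/-- `p` belongs to the sail of colour `i` (left for `one`, right for `two`) over `R`. -/
def InSail {V : Type u} (R : Color → V → V → Prop) (i : Color) (p : V × V) : Prop :=
  Relation.ReflTransGen (R i) (i.other.proj p) (i.proj p)

/-- The edges of colour `i` in the union of sails over `R`. -/
def SailEdge {V : Type u} (R : Color → V → V → Prop) (i : Color) (p q : V × V) : Prop :=
  i.proj p = i.proj q ∧
    ((InSail R i p ∧ InSail R i q ∧ R i (i.other.proj p) (i.other.proj q)) ∨
      (InSail R i.other p ∧ InSail R i.other q ∧ R i.other (i.other.proj p) (i.other.proj q)))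

/-- The 2-coloured digraph made of the sails over the relations `R`. -/
def sails {V : Type u} (R : Color → V → V → Prop) : TwoColoredDigraph.{u} where
  V := {p : V × V // InSail R .one p ∨ InSail R .two p}
  E i p q := SailEdge R i p.1 q.1

theorem InSail.mem {V : Type u} {R : Color → V → V → Prop} {i : Color} {p : V × V}
    (h : InSail R i p) : InSail R .one p ∨ InSail R .two p := by
  cases i
  · exact Or.inl h
  · exact Or.inr h

theorem inSail_cases {V : Type u} {R : Color → V → V → Prop} (i : Color) {p : V × V}
    (h : InSail R .one p ∨ InSail R .two p) : InSail R i p ∨ InSail R i.other p := by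
  cases i
  · exact h
  · exact h.symm

/-- The two edge relations of a covering over a grid, with the coordinates `g` of the vertices in
the grid and the sizes `n` of the grid, in a form that treats the two directions alike. -/
structure GridSystem {V : Type u} (R : Color → V → V → Prop) (g : Color → V → ℕ)
    (n : Color → ℕ) : Prop where
  succ : ∀ {i x y}, R i x y → g i y = g i x + 1 ∧ g i.other y = g i.other x
  le : ∀ i x, g i x ≤ n i
  out_unique : ∀ {i x y y'}, R i x y → R i x y' → y = y'
  in_unique : ∀ {i x x' y}, R i x y → R i x' y → x = x'
  exists_out : ∀ {i x}, g i x < n i → ∃ y, R i x y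
  exists_in : ∀ {i y}, 0 < g i y → ∃ x, R i x y

namespace GridSystem

variable {V : Type u} {R : Color → V → V → Prop} {g : Color → V → ℕ} {n : Color → ℕ}

theorem reach_coord (S : GridSystem R g n) {i : Color} {x y : V}
    (h : Relation.ReflTransGen (R i) x y) :
    (x = y ∨ g i x < g i y) ∧ g i x ≤ g i y ∧ g i.other y = g i.other x := by
  induction h with
  | refl => exact ⟨Or.inl rfl, le_rfl, rfl⟩
  | tail _ h ih =>
    have := S.succ h
    exact ⟨Or.inr (by omega), by omega, by omega⟩

theorem inSail_coord (S : GridSystem R g n) {i : Color} {p : V × V} (h : InSail R i p) :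
    (i.other.proj p = i.proj p ∨ g i (i.other.proj p) < g i (i.proj p)) ∧
      g i (i.other.proj p) ≤ g i (i.proj p) ∧
      g i.other (i.proj p) = g i.other (i.other.proj p) :=
  S.reach_coord h

theorem inSail_coord' (S : GridSystem R g n) {i : Color} {p : V × V} (h : InSail R i.other p) :
    (i.proj p = i.other.proj p ∨ g i.other (i.proj p) < g i.other (i.other.proj p)) ∧
      g i.other (i.proj p) ≤ g i.other (i.other.proj p) ∧
      g i (i.other.proj p) = g i (i.proj p) := by
  have := S.inSail_coord h
  simpa only [Color.other_other] using this

theorem succ' (S : GridSystem R g n) {i : Color} {x y : V} (h : R i.other x y) :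
    g i.other y = g i.other x + 1 ∧ g i y = g i x := by
  have := S.succ h
  simpa only [Color.other_other] using this

/-- The value of `t_i` on the sails. -/
def sailT (g : Color → V → ℕ) (i : Color) (p : V × V) : ℕ :=
  g i (i.other.proj p) + (g i.other (i.other.proj p) - g i.other (i.proj p))

/-- The value of `h_i` on the sails. -/
def sailH (g : Color → V → ℕ) (n : Color → ℕ) (i : Color) (p : V × V) : ℕ :=
  (g i (i.proj p) - g i (i.other.proj p)) + (n i.other - g i.other (i.other.proj p))

theorem sailT_other (i : Color) (p : V × V) : sailT g i.other p =
    g i.other (i.proj p) + (g i (i.proj p) - g i (i.other.proj p)) := by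
  simp only [sailT, Color.other_other]

theorem sailH_other (i : Color) (p : V × V) : sailH g n i.other p =
    (g i.other (i.other.proj p) - g i.other (i.proj p)) + (n i - g i (i.proj p)) := by
  simp only [sailH, Color.other_other]

theorem sailEdge_other {i : Color} {p q : V × V} : SailEdge R i.other p q ↔
    i.other.proj p = i.other.proj q ∧
    ((InSail R i.other p ∧ InSail R i.other q ∧ R i.other (i.proj p) (i.proj q)) ∨
      (InSail R i p ∧ InSail R i q ∧ R i (i.proj p) (i.proj q))) := by
  simp only [SailEdge, Color.other_other]

/-- An `i`-edge of a sail of colour `i` has label 0 and starts off the diagonal. -/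
theorem edge_same (S : GridSystem R g n) {i : Color} {p q : V × V} (he : i.proj p = i.proj q)
    (hp : InSail R i p) (hq : InSail R i q) (hR : R i (i.other.proj p) (i.other.proj q)) :
    sailT g i q = sailT g i p + 1 ∧ sailH g n i p = sailH g n i q + 1 ∧
      sailT g i.other p = sailT g i.other q + 1 ∧ sailH g n i.other q = sailH g n i.other p ∧
      g i (i.other.proj p) < g i (i.proj p) := by
  have h1 := S.inSail_coord hp
  have h2 := S.inSail_coord hq
  have h3 := S.succ hR
  rw [sailT_other, sailT_other, sailH_other, sailH_other]
  simp only [sailT, sailH]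
  rw [he] at *
  have := S.le i.other (i.other.proj q)
  have := S.le i (i.proj q)
  omega

/-- An `i`-edge of a sail of the other colour has label 1 and ends off the diagonal. -/
theorem edge_other (S : GridSystem R g n) {i : Color} {p q : V × V} (he : i.proj p = i.proj q)
    (hp : InSail R i.other p) (hq : InSail R i.other q)
    (hR : R i.other (i.other.proj p) (i.other.proj q)) :
    sailT g i q = sailT g i p + 1 ∧ sailH g n i p = sailH g n i q + 1 ∧
      sailT g i.other q = sailT g i.other p ∧ sailH g n i.other q = sailH g n i.other p + 1 ∧
      g i.other (i.proj q) < g i.other (i.other.proj q) := by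
  have h1 := S.inSail_coord' hp
  have h2 := S.inSail_coord' hq
  have h3 := S.succ' hR
  rw [sailT_other, sailT_other, sailH_other, sailH_other]
  simp only [sailT, sailH]
  rw [he] at *
  -- Subtraction in `sailH` is truncated; the bound makes it genuine.
  have := S.le i.other (i.other.proj q)
  have := S.le i (i.proj q)
  omega

theorem mem_of_diag {i : Color} {p : V × V} (h : i.other.proj p = i.proj p) (k : Color) :
    InSail R k p := by
  rcases Color.eq_or_eq_other i k with rfl | rfl
  · simp only [InSail, h, Relation.ReflTransGen.refl]
  · simp only [InSail, h, Color.other_other, Relation.ReflTransGen.refl]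

/-- In each sail one of the two differences in `sailT` and `sailH` vanishes, so the same formulas
serve both. All mixed cases are excluded by `edge_same` and `edge_other`: a vertex off the diagonal
lies in one sail only. -/
theorem sails_data (S : GridSystem R g n) : TwoColoredDigraph.WCData (sails R)
    (fun i p => sailT g i p.1) (fun i p => sailH g n i p.1) where
  out_unique := by
    rintro i ⟨p, _⟩ ⟨q, _⟩ ⟨q', _⟩ ⟨he, h⟩ ⟨he', h'⟩
    apply Subtype.ext
    refine i.proj_ext (he.symm.trans he') ?_
    dsimp only at he he' h h' ⊢
    rcases h with ⟨h1, h2, h3⟩ | ⟨h1, h2, h3⟩ <;> rcases h' with ⟨h1', h2', h3'⟩ | ⟨h1', h2', h3'⟩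
    · exact S.out_unique h3 h3'
    · have := S.edge_same he h1 h2 h3
      have := S.inSail_coord' h1'
      omega
    · have := S.edge_same he' h1' h2' h3'
      have := S.inSail_coord' h1
      omega
    · exact S.out_unique h3 h3'
  in_unique := by
    rintro i ⟨p, _⟩ ⟨p', _⟩ ⟨q, _⟩ ⟨he, h⟩ ⟨he', h'⟩
    apply Subtype.ext
    refine i.proj_ext (he.trans he'.symm) ?_
    dsimp only at he he' h h' ⊢
    rcases h with ⟨h1, h2, h3⟩ | ⟨h1, h2, h3⟩ <;> rcases h' with ⟨h1', h2', h3'⟩ | ⟨h1', h2', h3'⟩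
    · exact S.in_unique h3 h3'
    · have := S.edge_other he' h1' h2' h3'
      have := S.inSail_coord h2
      omega
    · have := S.edge_other he h1 h2 h3
      have := S.inSail_coord h2'
      omega
    · exact S.in_unique h3 h3'
  t_succ := by
    rintro i ⟨p, _⟩ ⟨q, _⟩ ⟨he, ⟨h1, h2, h3⟩ | ⟨h1, h2, h3⟩⟩
    · exact (S.edge_same he h1 h2 h3).1
    · exact (S.edge_other he h1 h2 h3).1
  h_succ := by
    rintro i ⟨p, _⟩ ⟨q, _⟩ ⟨he, ⟨h1, h2, h3⟩ | ⟨h1, h2, h3⟩⟩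
    · exact (S.edge_same he h1 h2 h3).2.1
    · exact (S.edge_other he h1 h2 h3).2.1
  label_cases := by
    rintro i ⟨p, _⟩ ⟨q, _⟩ ⟨he, ⟨h1, h2, h3⟩ | ⟨h1, h2, h3⟩⟩
    · have := S.edge_same he h1 h2 h3
      exact Or.inl ⟨this.2.2.1, this.2.2.2.1⟩
    · have := S.edge_other he h1 h2 h3
      exact Or.inr ⟨this.2.2.1, this.2.2.2.1⟩
  exists_in := by
    rintro i ⟨p, hp⟩ ht
    dsimp only at ht
    -- In a sail of colour `i` a predecessor exists because the moving coordinate can decrease in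
    -- the grid. In the other sail, off the diagonal, it is the previous step back towards the
    -- diagonal.
    by_cases hs : InSail R i p
    · have h1 := S.inSail_coord hs
      obtain ⟨z, hz⟩ := S.exists_in (i := i) (y := i.other.proj p) (by
        simp only [sailT] at ht; omega)
      have hq : InSail R i (i.pair (i.proj p) z) := by
        simp only [InSail, Color.proj_pair, Color.proj_other_pair]
        exact Relation.ReflTransGen.head hz hs
      exact ⟨⟨_, hq.mem⟩, by simp, Or.inl ⟨hq, hs, by simpa using hz⟩⟩
    · have ho := (inSail_cases i hp).resolve_left hs
      have hd := ho
      simp only [InSail, Color.other_other] at hd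
      rcases Relation.ReflTransGen.cases_tail hd with hd | ⟨z, hz, hz'⟩
      · exact absurd (mem_of_diag hd i) hs
      · have hq : InSail R i.other (i.pair (i.proj p) z) := by
          simpa only [InSail, Color.proj_pair, Color.proj_other_pair, Color.other_other] using hz
        exact ⟨⟨_, hq.mem⟩, by simp, Or.inr ⟨hq, ho, by simpa using hz'⟩⟩
  exists_out := by
    rintro i ⟨p, hp⟩ ht
    dsimp only at ht
    by_cases hs : InSail R i.other p
    · have h1 := S.inSail_coord' hs
      obtain ⟨z, hz⟩ := S.exists_out (i := i.other) (x := i.other.proj p) (by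
        simp only [sailH] at ht; omega)
      have hq : InSail R i.other (i.pair (i.proj p) z) := by
        simp only [InSail, Color.proj_pair, Color.proj_other_pair, Color.other_other] at hs ⊢
        exact hs.tail hz
      exact ⟨⟨_, hq.mem⟩, by simp, Or.inr ⟨hs, hq, by simpa using hz⟩⟩
    · have ho := (inSail_cases i hp).resolve_right hs
      rcases Relation.ReflTransGen.cases_head ho with hd | ⟨z, hz, hz'⟩
      · exact absurd (mem_of_diag hd i.other) hs
      · have hq : InSail R i (i.pair (i.proj p) z) := by
          simpa only [InSail, Color.proj_pair, Color.proj_other_pair] using hz'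
        exact ⟨⟨_, hq.mem⟩, by simp, Or.inl ⟨ho, hq, by simpa using hz⟩⟩
  label_mono := by
    rintro i ⟨p, _⟩ ⟨q, _⟩ ⟨r, _⟩ ⟨he, h⟩ ⟨he', h'⟩ hl
    dsimp only at he he' h h' hl ⊢
    rcases h with ⟨h1, h2, h3⟩ | ⟨h1, h2, h3⟩
    · have := S.edge_same he h1 h2 h3
      omega
    rcases h' with ⟨h1', h2', h3'⟩ | ⟨h1', h2', h3'⟩
    · have := S.edge_other he h1 h2 h3
      have := S.inSail_coord h1'
      omega
    · exact (S.edge_other he' h1' h2' h3').2.2.2.1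
  square_out := by
    rintro i ⟨p, _⟩ ⟨q, _⟩ ⟨q', _⟩ ⟨he, h⟩ hE hl
    obtain ⟨he', h'⟩ := sailEdge_other.1 hE
    dsimp only at he he' h h' hl ⊢
    rcases h with ⟨h1, h2, h3⟩ | ⟨h1, h2, h3⟩
    swap
    · have := S.edge_other he h1 h2 h3
      omega
    rcases h' with ⟨h1', h2', h3'⟩ | ⟨h1', h2', h3'⟩
    · have := S.edge_same he h1 h2 h3
      have := S.inSail_coord' h1'
      omega
    -- Both edges lie in the sail of colour `i` and move different coordinates; the fourth corner
    -- takes the moved value of each.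
    have hw : InSail R i (i.pair (i.proj q') (i.other.proj q)) := by
      simp only [InSail, Color.proj_pair, Color.proj_other_pair] at h2 ⊢
      exact h2.tail (by rw [← he]; exact h3')
    refine ⟨?_, ⟨_, hw.mem⟩, sailEdge_other.2 ⟨by simp, Or.inr ⟨h2, hw, ?_⟩⟩,
      by simp, Or.inl ⟨h2', hw, ?_⟩⟩
    · have := S.edge_other (i := i.other) he' (by simpa using h1') (by simpa using h2')
        (by simpa using h3')
      simp only [Color.other_other] at this
      exact this.2.2.2.1
    · simpa [← he] using h3'
    · simpa [← he'] using h3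
  square_in := by
    rintro i ⟨q, _⟩ ⟨p, _⟩ ⟨p', _⟩ ⟨he, h⟩ hE hl
    obtain ⟨he', h'⟩ := sailEdge_other.1 hE
    dsimp only at he he' h h' hl ⊢
    rcases h with ⟨h1, h2, h3⟩ | ⟨h1, h2, h3⟩
    · have := S.edge_same he h1 h2 h3
      omega
    rcases h' with ⟨h1', h2', h3'⟩ | ⟨h1', h2', h3'⟩
    swap
    · have := S.edge_other he h1 h2 h3
      have := S.inSail_coord h2'
      omega
    have hw : InSail R i.other (i.pair (i.proj p') (i.other.proj p)) := by
      simp only [InSail, Color.proj_pair, Color.proj_other_pair, Color.other_other] at h1 ⊢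
      exact Relation.ReflTransGen.head h3' (by rw [← he]; exact h1)
    refine ⟨?_, ⟨_, hw.mem⟩, sailEdge_other.2 ⟨by simp, Or.inl ⟨hw, h1, ?_⟩⟩,
      by simp, Or.inr ⟨hw, h1', ?_⟩⟩
    · have := S.edge_same (i := i.other) he' h1' h2' (by simpa using h3')
      simp only [Color.other_other] at this
      exact this.2.2.2.1
    · simpa [he] using h3'
    · simpa [he'] using h3

/-- The diagonal vertex at `x`. -/
def diag (R : Color → V → V → Prop) (x : V) : (sails R).V :=
  ⟨(x, x), Or.inl Relation.ReflTransGen.refl⟩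

/-- The middle vertex lies next to the diagonal, in the sail of colour `i`. The sail of the other
colour is impossible, since the first edge would then have to move the coordinate backwards. -/
theorem edge_diag (S : GridSystem R g n) {i : Color} {x y : V} :
    (∃ w, (sails R).E i.other (diag R x) w ∧ (sails R).E i w (diag R y)) ↔ R i x y := by
  constructor
  · rintro ⟨⟨w, hw⟩, h, h'⟩
    obtain ⟨he, h⟩ := sailEdge_other.1 h
    obtain ⟨he', h'⟩ := h'
    simp only [diag, Color.proj_diag] at he h he' h'
    subst he he'
    rcases h with ⟨h1, h2, h3⟩ | ⟨h1, h2, h3⟩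
    · have := S.inSail_coord' h2
      have := S.succ' h3
      omega
    · exact h3
  · intro h
    have hw : InSail R i (i.pair y x) := by
      simpa [InSail] using Relation.ReflTransGen.single h
    refine ⟨⟨_, hw.mem⟩, sailEdge_other.2 ⟨by simp [diag], Or.inr ⟨?_, hw, by simpa [diag] using h⟩⟩,
      by simp [diag], Or.inl ⟨hw, ?_, by simpa [diag] using h⟩⟩ <;>
    simp [diag, InSail, Relation.ReflTransGen.refl]

theorem connected (S : GridSystem R g n) (hR : WeaklyConnected fun x y => ∃ i, R i x y) :
    (sails R).Connected := by
  obtain ⟨⟨x0⟩, hc⟩ := hR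
  refine ⟨⟨diag R x0⟩, ?_⟩
  have hd : ∀ x y, Relation.EqvGen (fun p q => ∃ i, (sails R).E i p q) (diag R x) (diag R y) := by
    intro x y
    induction hc x y with
    | rel x y h =>
      obtain ⟨i, h⟩ := h
      obtain ⟨w, h1, h2⟩ := S.edge_diag.2 h
      exact (Relation.EqvGen.rel _ _ ⟨_, h1⟩).trans _ _ _ (Relation.EqvGen.rel _ _ ⟨_, h2⟩)
    | refl => exact Relation.EqvGen.refl _
    | symm _ _ _ ih => exact ih.symm
    | trans _ _ _ _ _ ih ih' => exact ih.trans _ _ _ ih'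
  have hp : ∀ p : (sails R).V, ∃ x,
      Relation.EqvGen (fun p q => ∃ i, (sails R).E i p q) p (diag R x) := by
    rintro ⟨p, hp⟩
    -- Inside a sail of colour `i`, the `i`-edges lead from `p` to the diagonal vertex at `y`.
    have key : ∀ (i : Color) (y x : V), Relation.ReflTransGen (R i) x y → ∀ p : (sails R).V,
        p.1 = i.pair y x →
        Relation.EqvGen (fun p q => ∃ i, (sails R).E i p q) p (diag R y) := by
      intro i y x h
      induction h using Relation.ReflTransGen.head_induction_on with
      | refl =>
        intro p hp
        have : p = diag R y := Subtype.ext (by rw [hp]; cases i <;> rfl)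
        subst this
        exact Relation.EqvGen.refl _
      | head h h' ih =>
        rename_i x z
        rintro ⟨p, hm⟩ rfl
        have hs : InSail R i (i.pair y z) := by simpa [InSail] using h'
        have hs' : InSail R i (i.pair y x) := by simpa [InSail] using h'.head h
        exact (Relation.EqvGen.rel _ (⟨_, hs.mem⟩ : (sails R).V)
          ⟨i, by simp, Or.inl ⟨hs', hs, by simpa using h⟩⟩).trans _ _ _ (ih ⟨_, hs.mem⟩ rfl)
    have hi : ∃ i, InSail R i p := hp.elim (fun h => ⟨_, h⟩) fun h => ⟨_, h⟩
    obtain ⟨i, hi⟩ := hi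
    exact ⟨i.proj p, key i _ _ hi ⟨p, hp⟩ (i.proj_ext (by simp) (by simp))⟩
  intro p q
  obtain ⟨x, hx⟩ := hp p
  obtain ⟨y, hy⟩ := hp q
  exact (hx.trans _ _ _ (hd x y)).trans _ _ _ hy.symm

theorem isWC (S : GridSystem R g n) (hR : WeaklyConnected fun x y => ∃ i, R i x y) :
    (sails R).IsWC := S.sails_data.isWC (S.connected hR)

end GridSystem

/-! ### Critical vertices and recovery of the grid data from the sails -/

namespace TwoColoredDigraph

variable {K L : TwoColoredDigraph.{u}}

theorem transGen_iso (e : K.V ≃ L.V) (he : ∀ i x y, L.E i (e x) (e y) ↔ K.E i x y) (i : Color)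
    (x y : K.V) : Relation.TransGen (L.E i) (e x) (e y) ↔ Relation.TransGen (K.E i) x y := by
  constructor
  · intro h
    have := Relation.TransGen.lift (p := K.E i) e.symm (fun a b hab => by
      change K.E i (e.symm a) (e.symm b)
      rw [← he, e.apply_symm_apply, e.apply_symm_apply]; exact hab) _ _ h
    simpa [Function.onFun] using this
  · intro h
    exact Relation.TransGen.lift (p := L.E i) e (fun a b hab => (he i a b).2 hab) _ _ h

theorem t_iso (e : K.V ≃ L.V) (he : ∀ i x y, L.E i (e x) (e y) ↔ K.E i x y) (i : Color)
    (x : K.V) : L.t i (e x) = K.t i x := by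
  have : {w : L.V | Relation.TransGen (L.E i) w (e x)} =
      e '' {w : K.V | Relation.TransGen (K.E i) w x} := by
    ext w
    rw [Equiv.image_eq_preimage_symm, Set.mem_preimage, Set.mem_ofPred, Set.mem_ofPred,
      ← transGen_iso e he, e.apply_symm_apply]
  rw [t, t, this, Set.ncard_image_of_injective _ e.injective]

theorem h_iso (e : K.V ≃ L.V) (he : ∀ i x y, L.E i (e x) (e y) ↔ K.E i x y) (i : Color)
    (x : K.V) : L.h i (e x) = K.h i x := by
  have : {w : L.V | Relation.TransGen (L.E i) (e x) w} =
      e '' {w : K.V | Relation.TransGen (K.E i) x w} := by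
    ext w
    rw [Equiv.image_eq_preimage_symm, Set.mem_preimage, Set.mem_ofPred, Set.mem_ofPred,
      ← transGen_iso e he, e.apply_symm_apply]
  rw [h, h, this, Set.ncard_image_of_injective _ e.injective]

/-- The critical vertices: those critical on the lines of both colours. -/
def Crit (K : TwoColoredDigraph.{u}) (h : Color → K.V → ℕ) (v : K.V) : Prop :=
  ∀ i, WCData.LineCrit h i v

theorem crit_iso (e : K.V ≃ L.V) (he : ∀ i x y, L.E i (e x) (e y) ↔ K.E i x y) (x : K.V) :
    L.Crit L.h (e x) ↔ K.Crit K.h x := by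
  simp only [Crit, WCData.LineCrit, WCData.One, WCData.Zero, e.surjective.forall, he,
    h_iso e he]

end TwoColoredDigraph

namespace GridSystem

variable {V : Type u} {R : Color → V → V → Prop} {g : Color → V → ℕ} {n : Color → ℕ}

/-- Off the diagonal, in a sail of colour `i`, the vertex is left by an `i`-edge of label 0. An edge
of label 0 starts off the diagonal and one of label 1 ends off it, so neither can spoil a diagonal
vertex. -/
theorem crit_iff (S : GridSystem R g n) (p : (sails R).V) :
    (sails R).Crit (sails R).h p ↔ ∃ x, p = diag R x := by
  have hh : (sails R).h = fun i p => sailH g n i p.1 := by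
    funext i p; exact S.sails_data.h_eq i p
  rw [hh]
  constructor
  · obtain ⟨p, hp⟩ := p
    intro hc
    have hi : ∃ i, InSail R i p := hp.elim (fun h => ⟨_, h⟩) fun h => ⟨_, h⟩
    obtain ⟨i, hi⟩ := hi
    rcases Relation.ReflTransGen.cases_head hi with hd | ⟨z, hz, hz'⟩
    · exact ⟨i.proj p, Subtype.ext (i.proj_ext (by simp [diag]) (by simp [diag, hd]))⟩
    · have hq : InSail R i (i.pair (i.proj p) z) := by
        simpa only [InSail, Color.proj_pair, Color.proj_other_pair] using hz'
      have hz'' : R i (i.other.proj p) (i.other.proj (i.pair (i.proj p) z)) := by simpa using hz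
      have := S.edge_same (by simp) hi hq hz''
      exact absurd ⟨⟨by simp, Or.inl ⟨hi, hq, hz''⟩⟩, this.2.2.2.1⟩
        ((hc i).2 ⟨_, hq.mem⟩)
  · rintro ⟨x, rfl⟩ i
    constructor
    · rintro ⟨q, hq⟩ ⟨⟨he, h⟩, hl⟩
      dsimp only at he h hl
      rcases h with ⟨h1, h2, h3⟩ | ⟨h1, h2, h3⟩
      · have := S.edge_same he h1 h2 h3
        omega
      · have := S.edge_other he h1 h2 h3
        simp [diag] at this
    · rintro ⟨q, hq⟩ ⟨⟨he, h⟩, hl⟩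
      dsimp only at he h hl
      rcases h with ⟨h1, h2, h3⟩ | ⟨h1, h2, h3⟩
      · have := S.edge_same he h1 h2 h3
        simp [diag] at this
      · have := S.edge_other he h1 h2 h3
        omega

theorem t_diag (S : GridSystem R g n) (i : Color) (x : V) : (sails R).t i (diag R x) = g i x := by
  rw [S.sails_data.t_eq]
  simp [sailT, diag]

theorem h_diag (S : GridSystem R g n) (i : Color) (x : V) :
    (sails R).h i (diag R x) = n i.other - g i.other x := by
  rw [S.sails_data.h_eq]
  simp [sailH, diag]

theorem diag_injective : Function.Injective (diag R) := fun _ _ h =>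
  congrArg (fun p : (sails R).V => p.1.1) h

variable {V' : Type u} {R' : Color → V' → V' → Prop} {g' : Color → V' → ℕ} {n' : Color → ℕ}

/-- A grid system can be recovered from its sails. -/
theorem exists_equiv_of_sails (S : GridSystem R g n) (S' : GridSystem R' g' n') [Nonempty V]
    (h : (sails R).Isomorphic (sails R')) :
    n = n' ∧ ∃ e : V ≃ V', (∀ i x y, R' i (e x) (e y) ↔ R i x y) ∧ ∀ i x, g' i (e x) = g i x := by
  obtain ⟨e, he⟩ := h
  have h1 : ∀ x, ∃ y, e (diag R x) = diag R' y := fun x =>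
    (S'.crit_iff _).1 ((TwoColoredDigraph.crit_iso e he _).2 ((S.crit_iff _).2 ⟨x, rfl⟩))
  choose f hf using h1
  have hbij : Function.Bijective f := by
    constructor
    · intro x y hxy
      apply diag_injective (R := R)
      apply e.injective
      rw [hf, hf, hxy]
    · intro y
      obtain ⟨x, hx⟩ := (S.crit_iff (e.symm (diag R' y))).1
        ((TwoColoredDigraph.crit_iso e he _).1 (by
          rw [e.apply_symm_apply]; exact (S'.crit_iff _).2 ⟨y, rfl⟩))
      refine ⟨x, diag_injective (R := R') ?_⟩
      rw [← hf, ← hx, e.apply_symm_apply]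
  have hg : ∀ i x, g' i (f x) = g i x := fun i x => by
    rw [← S'.t_diag, ← hf, TwoColoredDigraph.t_iso e he, S.t_diag]
  refine ⟨?_, Equiv.ofBijective f hbij, ?_, hg⟩
  · funext i
    -- The size `n i` is `t i + h i.other` at any diagonal vertex, so one vertex is needed.
    obtain ⟨x⟩ := ‹Nonempty V›
    have h2 := S'.h_diag i.other (f x)
    rw [← hf, TwoColoredDigraph.h_iso e he, S.h_diag, Color.other_other, hg] at h2
    have := S.le i x
    have := S'.le i (f x)
    rw [hg] at this
    omega
  · intro i x y
    rw [← S.edge_diag, Equiv.ofBijective_apply, Equiv.ofBijective_apply, ← S'.edge_diag,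
      e.surjective.exists]
    simp only [← hf, he]

theorem reflTransGen_iso (e : V ≃ V') (he : ∀ i x y, R' i (e x) (e y) ↔ R i x y) (i : Color)
    (x y : V) : Relation.ReflTransGen (R' i) (e x) (e y) ↔ Relation.ReflTransGen (R i) x y := by
  constructor
  · intro h
    have := Relation.ReflTransGen.lift (p := R i) e.symm (fun a b hab => by
      change R i (e.symm a) (e.symm b)
      rw [← he, e.apply_symm_apply, e.apply_symm_apply]; exact hab) _ _ h
    simpa [Function.onFun] using this
  · intro h
    exact Relation.ReflTransGen.lift (p := R' i) e (fun a b hab => (he i a b).2 hab) _ _ h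

theorem sails_iso (e : V ≃ V') (he : ∀ i x y, R' i (e x) (e y) ↔ R i x y) :
    (sails R).Isomorphic (sails R') := by
  have hproj : ∀ (i : Color) (p : V × V), i.proj (e.prodCongr e p) = e (i.proj p) := by
    intro i p; cases i <;> rfl
  have hin : ∀ i p, InSail R' i (e.prodCongr e p) ↔ InSail R i p := fun i p => by
    simp only [InSail, hproj, reflTransGen_iso e he]
  refine ⟨(e.prodCongr e).subtypeEquiv fun p => ?_, fun i p q => ?_⟩
  · rw [hin, hin]
  · change SailEdge R' i (e.prodCongr e p.1) (e.prodCongr e q.1) ↔ SailEdge R i p.1 q.1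
    simp only [SailEdge, hin, hproj, e.apply_eq_iff_eq, he]

end GridSystem

/-! ### Coverings as grid systems -/

namespace GridCovering

variable (C : GridCovering.{u})

/-- The two edge relations of a covering. -/
def rel : Color → C.V → C.V → Prop
  | .one => C.HEdge
  | .two => C.VEdge

/-- The coordinates of the image of a vertex in the grid. -/
def coord : Color → C.V → ℕ
  | .one => fun x => (C.γ x).1
  | .two => fun x => (C.γ x).2

/-- The sizes of the grid. -/
def size : Color → ℕ
  | .one => C.a
  | .two => C.b

theorem sailGraph_eq : C.sailGraph = sails C.rel := by
  unfold sailGraph sails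
  congr 1
  funext i p q
  cases i
  · rfl
  · apply propext
    simp only [SailEdge]
    exact and_congr_right fun _ => or_comm

variable {C}

theorem adj_iff {x y : C.V} : C.G.Adj x y ↔ ∃ i, C.rel i x y := by
  constructor
  · intro h
    rcases C.hom x y h with h1 | h1
    · exact ⟨.one, h, h1.2⟩
    · exact ⟨.two, h, h1.1⟩
  · rintro ⟨_ | _, h⟩
    · exact h.1
    · exact h.1

theorem rel_coord {i : Color} {x y : C.V} (h : C.rel i x y) :
    C.coord i y = C.coord i x + 1 ∧ C.coord i.other y = C.coord i.other x := by
  cases i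
  · have := HEdge.coord h
    exact ⟨this.1.symm, congrArg Fin.val this.2.symm⟩
  · have := VEdge.coord h
    exact ⟨this.2.symm, congrArg Fin.val this.1.symm⟩

theorem rel_of_adj {i : Color} {x y : C.V} (h : C.G.Adj x y)
    (hc : C.coord i y = C.coord i x + 1) : C.rel i x y := by
  obtain ⟨k, hk⟩ := adj_iff.1 h
  rcases Color.eq_or_eq_other i k with rfl | rfl
  · exact hk
  · have := (rel_coord hk).2
    rw [Color.other_other] at this
    omega

theorem γ_ext {x y : C.V} (i : Color) (h : C.coord i x = C.coord i y)
    (h' : C.coord i.other x = C.coord i.other y) : C.γ x = C.γ y := by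
  cases i
  · exact Prod.ext (Fin.ext h) (Fin.ext h')
  · exact Prod.ext (Fin.ext h') (Fin.ext h)

theorem exists_nbhd {x : C.V} {q : Fin (C.a + 1) × Fin (C.b + 1)}
    (hq : (grid C.a C.b).Adj (C.γ x) q ∨ (grid C.a C.b).Adj q (C.γ x)) :
    ∃ y, C.γ y = q ∧ (C.G.Adj x y ∨ C.G.Adj y x) := by
  obtain ⟨y, hy, rfl⟩ := (C.nbhd_bijOn x).surjOn (Or.inr hq)
  -- The grid has no loops, so the lift of a neighbour is not `x` itself.
  refine ⟨y, rfl, hy.resolve_left ?_⟩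
  rintro rfl
  simp [grid] at hq

theorem gridSystem (C : GridCovering.{u}) : GridSystem C.rel C.coord C.size where
  succ := rel_coord
  le := by
    rintro (_ | _) x
    · exact Nat.le_of_lt_succ (C.γ x).1.isLt
    · exact Nat.le_of_lt_succ (C.γ x).2.isLt
  out_unique := by
    intro i x y y' h h'
    have h1 := rel_coord h
    have h2 := rel_coord h'
    exact (C.nbhd_bijOn x).injOn (Or.inr (Or.inl (adj_iff.2 ⟨i, h⟩)))
      (Or.inr (Or.inl (adj_iff.2 ⟨i, h'⟩))) (γ_ext i (by omega) (by omega))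
  in_unique := by
    intro i x x' y h h'
    have h1 := rel_coord h
    have h2 := rel_coord h'
    exact (C.nbhd_bijOn y).injOn (Or.inr (Or.inr (adj_iff.2 ⟨i, h⟩)))
      (Or.inr (Or.inr (adj_iff.2 ⟨i, h'⟩))) (γ_ext i (by omega) (by omega))
  exists_out := by
    intro i x hx
    have key : ∃ y, C.coord i y = C.coord i x + 1 ∧ (C.G.Adj x y ∨ C.G.Adj y x) := by
      cases i
      · obtain ⟨y, hy, hy'⟩ := C.exists_nbhd (x := x)
          (q := (⟨(C.γ x).1 + 1, Nat.succ_lt_succ hx⟩, (C.γ x).2)) (Or.inl (Or.inl ⟨rfl, rfl⟩))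
        exact ⟨y, by simp [coord, hy], hy'⟩
      · obtain ⟨y, hy, hy'⟩ := C.exists_nbhd (x := x)
          (q := ((C.γ x).1, ⟨(C.γ x).2 + 1, Nat.succ_lt_succ hx⟩)) (Or.inl (Or.inr ⟨rfl, rfl⟩))
        exact ⟨y, by simp [coord, hy], hy'⟩
    -- The lifted edge must point from `x` to `y`, because no coordinate decreases along an edge.
    obtain ⟨y, hy, h | h⟩ := key
    · exact ⟨y, rel_of_adj h hy⟩
    · obtain ⟨k, hk⟩ := adj_iff.1 h
      have := rel_coord hk
      rcases Color.eq_or_eq_other i k with rfl | rfl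
      · omega
      · rw [Color.other_other] at this
        omega
  exists_in := by
    intro i x hx
    have key : ∃ y, C.coord i x = C.coord i y + 1 ∧ (C.G.Adj x y ∨ C.G.Adj y x) := by
      cases i
      · have hlt := (C.γ x).1.isLt
        have h1 : ((C.γ x).1 : ℕ) - 1 + 1 = (C.γ x).1 := Nat.sub_add_cancel hx
        obtain ⟨y, hy, hy'⟩ := C.exists_nbhd (x := x)
          (q := (⟨(C.γ x).1 - 1, by omega⟩, (C.γ x).2)) (Or.inr (Or.inl ⟨h1, rfl⟩))
        exact ⟨y, by simp only [coord, hy]; exact h1.symm, hy'⟩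
      · have hlt := (C.γ x).2.isLt
        have h1 : ((C.γ x).2 : ℕ) - 1 + 1 = (C.γ x).2 := Nat.sub_add_cancel hx
        obtain ⟨y, hy, hy'⟩ := C.exists_nbhd (x := x)
          (q := ((C.γ x).1, ⟨(C.γ x).2 - 1, by omega⟩)) (Or.inr (Or.inr ⟨rfl, h1⟩))
        exact ⟨y, by simp only [coord, hy]; exact h1.symm, hy'⟩
    obtain ⟨y, hy, h | h⟩ := key
    · obtain ⟨k, hk⟩ := adj_iff.1 h
      have := rel_coord hk
      rcases Color.eq_or_eq_other i k with rfl | rfl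
      · omega
      · rw [Color.other_other] at this
        omega
    · exact ⟨y, rel_of_adj h hy⟩

theorem weaklyConnected_rel (C : GridCovering.{u}) :
    WeaklyConnected fun x y => ∃ i, C.rel i x y := by
  have : C.G.Adj = fun x y => ∃ i, C.rel i x y := by
    funext x y; exact propext adj_iff
  rw [← this]
  exact C.connected

theorem sailGraph_isWC (C : GridCovering.{u}) : C.sailGraph.IsWC := by
  rw [sailGraph_eq]
  exact C.gridSystem.isWC C.weaklyConnected_rel

theorem isomorphic_iff (C D : GridCovering.{u}) : C.Isomorphic D ↔
    C.size = D.size ∧ ∃ e : C.V ≃ D.V, (∀ i x y, D.rel i (e x) (e y) ↔ C.rel i x y) ∧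
      ∀ i x, D.coord i (e x) = C.coord i x := by
  constructor
  · rintro ⟨ha, hb, e, he, hγ⟩
    have hc : ∀ i x, D.coord i (e x) = C.coord i x := by
      rintro (_ | _) x
      · exact (hγ x).1
      · exact (hγ x).2
    refine ⟨?_, e, fun i x y => ⟨fun h => ?_, fun h => ?_⟩, hc⟩
    · funext i
      cases i
      · exact ha
      · exact hb
    · refine rel_of_adj ((he x y).1 (adj_iff.2 ⟨i, h⟩)) ?_
      rw [← hc, ← hc]
      exact (rel_coord h).1
    · refine rel_of_adj ((he x y).2 (adj_iff.2 ⟨i, h⟩)) ?_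
      rw [hc, hc]
      exact (rel_coord h).1
  · rintro ⟨hs, e, he, hc⟩
    exact ⟨congrFun hs .one, congrFun hs .two, e,
      fun x y => by rw [adj_iff, adj_iff]; simp only [he],
      fun x => ⟨hc .one x, hc .two x⟩⟩

theorem isomorphic_sailGraph_iff (C D : GridCovering.{u}) :
    C.sailGraph.Isomorphic D.sailGraph ↔ C.Isomorphic D := by
  rw [sailGraph_eq, sailGraph_eq, isomorphic_iff]
  constructor
  · have := C.connected.1
    exact C.gridSystem.exists_equiv_of_sails D.gridSystem
  · rintro ⟨-, e, he, -⟩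
    exact GridSystem.sails_iso e he

end GridCovering

/-! ### From a connected grid system to a covering -/

theorem grid_adj_iff {a b : ℕ} (p q : Fin (a + 1) × Fin (b + 1)) : (grid a b).Adj p q ↔
    ((p.1 : ℕ) + 1 = q.1 ∧ (p.2 : ℕ) = q.2) ∨ ((p.1 : ℕ) = q.1 ∧ (p.2 : ℕ) + 1 = q.2) := by
  simp only [grid, Fin.ext_iff]

theorem GridSystem.exists_covering {V : Type u} {R : Color → V → V → Prop} {g : Color → V → ℕ}
    {n : Color → ℕ} (S : GridSystem R g n) (hR : WeaklyConnected fun x y => ∃ i, R i x y) :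
    ∃ C : GridCovering.{u}, C.sailGraph.Isomorphic (sails R) := by
  let γ : V → Fin (n .one + 1) × Fin (n .two + 1) := fun x =>
    (⟨g .one x, Nat.lt_succ_of_le (S.le _ _)⟩, ⟨g .two x, Nat.lt_succ_of_le (S.le _ _)⟩)
  have γ1 : ∀ x, ((γ x).1 : ℕ) = g .one x := fun _ => rfl
  have γ2 : ∀ x, ((γ x).2 : ℕ) = g .two x := fun _ => rfl
  have γeq : ∀ x (q : Fin (n .one + 1) × Fin (n .two + 1)), γ x = q ↔
      g .one x = q.1 ∧ g .two x = q.2 := fun x q => by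
    rw [Prod.ext_iff, Fin.ext_iff, Fin.ext_iff]
  let G : Digraph V := ⟨fun x y => ∃ i, R i x y⟩
  have succ1 : ∀ {x y}, R .one x y → g .one y = g .one x + 1 ∧ g .two y = g .two x :=
    fun h => S.succ h
  have succ2 : ∀ {x y}, R .two x y → g .two y = g .two x + 1 ∧ g .one y = g .one x :=
    fun h => S.succ h
  have hadj : ∀ {x y}, G.Adj x y ↔ R .one x y ∨ R .two x y := by
    intro x y
    constructor
    · rintro ⟨_ | _, h⟩
      · exact Or.inl h
      · exact Or.inr h
    · rintro (h | h)
      · exact ⟨_, h⟩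
      · exact ⟨_, h⟩
  have hom : ∀ x y, G.Adj x y → (grid (n .one) (n .two)).Adj (γ x) (γ y) := by
    intro x y h
    rw [grid_adj_iff, γ1, γ1, γ2, γ2]
    rcases hadj.1 h with h | h
    · have := succ1 h; omega
    · have := succ2 h; omega
  have inj : ∀ v, Set.InjOn γ (nbhdVerts G v) := by
    intro v x hx y hy hxy
    have hc := (γeq x _).1 hxy
    rw [γ1, γ2] at hc
    have key : ∀ z, z ∈ nbhdVerts G v → z = v ∨ R .one v z ∨ R .two v z ∨ R .one z v ∨
        R .two z v := by
      rintro z (h | h | h)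
      · exact Or.inl h
      · rcases hadj.1 h with h | h <;> tauto
      · rcases hadj.1 h with h | h <;> tauto
    -- The vertex `v` and its possible neighbours of four kinds have distinct coordinate pairs, so
    -- only equal kinds remain, where uniqueness of edges applies.
    rcases key x hx with rfl | h | h | h | h <;> rcases key y hy with rfl | h' | h' | h' | h' <;>
    first
    | rfl
    | exact S.out_unique h h'
    | exact S.in_unique h h'
    | (exfalso
       try have a1 := succ1 h
       try have a2 := succ2 h
       try have a3 := succ1 h'
       try have a4 := succ2 h'
       omega)
  let C : GridCovering.{u} :=
    { V := V
      G := G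
      a := n .one
      b := n .two
      γ := γ
      connected := hR
      hom := hom
      nbhd_bijOn := by
        intro v
        refine ⟨?_, inj v, ?_⟩
        · rintro x (rfl | h | h)
          · exact Or.inl rfl
          · exact Or.inr (Or.inl (hom _ _ h))
          · exact Or.inr (Or.inr (hom _ _ h))
        · rintro q (rfl | h | h)
          · exact ⟨v, Or.inl rfl, rfl⟩
          · rw [grid_adj_iff, γ1, γ2] at h
            have q1 := q.1.isLt
            have q2 := q.2.isLt
            rcases h with h | h
            · obtain ⟨y, hy⟩ := S.exists_out (i := .one) (x := v) (by omega)
              have := succ1 hy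
              exact ⟨y, Or.inr (Or.inl ⟨_, hy⟩), (γeq _ _).2 (by omega)⟩
            · obtain ⟨y, hy⟩ := S.exists_out (i := .two) (x := v) (by omega)
              have := succ2 hy
              exact ⟨y, Or.inr (Or.inl ⟨_, hy⟩), (γeq _ _).2 (by omega)⟩
          · rw [grid_adj_iff, γ1, γ2] at h
            rcases h with h | h
            · obtain ⟨y, hy⟩ := S.exists_in (i := .one) (y := v) (by omega)
              have := succ1 hy
              exact ⟨y, Or.inr (Or.inr ⟨_, hy⟩), (γeq _ _).2 (by omega)⟩
            · obtain ⟨y, hy⟩ := S.exists_in (i := .two) (y := v) (by omega)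
              have := succ2 hy
              exact ⟨y, Or.inr (Or.inr ⟨_, hy⟩), (γeq _ _).2 (by omega)⟩
      nbhd_adj := by
        have asymm : ∀ p q, (grid (n .one) (n .two)).Adj p q →
            ¬ (grid (n .one) (n .two)).Adj q p := by
          intro p q h h'
          rw [grid_adj_iff] at h h'
          omega
        intro v x hx y hy
        have hv : v ∈ nbhdVerts G v := Or.inl rfl
        constructor
        · rintro ⟨h, h'⟩
          exact ⟨hom _ _ h, h'.imp (congrArg γ) (congrArg γ)⟩
        · rintro ⟨h, h'⟩
          rcases h' with h' | h'
          · obtain rfl := inj v hx hv h'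
            rcases hy with rfl | hy | hy
            · exact absurd h (asymm _ _ h)
            · exact ⟨hy, Or.inl rfl⟩
            · exact absurd (hom _ _ hy) (asymm _ _ h)
          · obtain rfl := inj v hy hv h'
            rcases hx with rfl | hx | hx
            · exact absurd h (asymm _ _ h)
            · exact absurd (hom _ _ hx) (asymm _ _ h)
            · exact ⟨hx, Or.inr rfl⟩ }
  have hrel : ∀ i x y, C.rel i x y ↔ R i x y := by
    have hc : ∀ i x, C.coord i x = g i x := by
      rintro (_ | _) x
      · rfl
      · rfl
    intro i x y
    constructor
    · intro h
      obtain ⟨k, hk⟩ : G.Adj x y := GridCovering.adj_iff.2 ⟨i, h⟩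
      have e1 := (GridCovering.rel_coord h).1
      rw [hc, hc] at e1
      rcases Color.eq_or_eq_other i k with rfl | rfl
      · exact hk
      · have := (S.succ' hk).2
        omega
    · intro h
      refine GridCovering.rel_of_adj (show G.Adj x y from ⟨i, h⟩) ?_
      rw [hc, hc]
      exact (S.succ h).1
  refine ⟨C, ?_⟩
  rw [GridCovering.sailGraph_eq]
  exact GridSystem.sails_iso (Equiv.refl V) fun i x y => (hrel i x y).symm

/-! ### Labelled squares and critical vertices of a WC-graph -/

namespace TwoColoredDigraph.WCData

variable {K : TwoColoredDigraph.{u}} {t h : Color → K.V → ℕ}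

theorem one_coord' (D : WCData K t h) {i : Color} {u v : K.V} (he : One h i.other u v) :
    t i.other v = t i.other u + 1 ∧ h i.other u = h i.other v + 1 ∧ t i v = t i u ∧
      h i v = h i u + 1 := by
  have := D.one_coord he
  simpa only [Color.other_other] using this

theorem zero_coord' (D : WCData K t h) {i : Color} {u v : K.V} (he : Zero h i.other u v) :
    t i.other v = t i.other u + 1 ∧ h i.other u = h i.other v + 1 ∧ t i u = t i v + 1 ∧
      h i v = h i u := by
  have := D.zero_coord he
  simpa only [Color.other_other] using this

theorem square_out' (D : WCData K t h) {i : Color} {u v v' : K.V} (he : K.E i.other u v)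
    (he' : K.E i u v') (hl : h i v = h i u) :
    h i.other v' = h i.other u + 1 ∧ ∃ w, K.E i v w ∧ K.E i.other v' w := by
  have := D.square_out he (by simpa only [Color.other_other] using he')
    (by simpa only [Color.other_other] using hl)
  simpa only [Color.other_other] using this

theorem square_in' (D : WCData K t h) {i : Color} {v u u' : K.V} (he : K.E i.other u v)
    (he' : K.E i u' v) (hl : h i v = h i u + 1) :
    h i.other v = h i.other u' ∧ ∃ w, K.E i w u ∧ K.E i.other w u' := by
  have := D.square_in he (by simpa only [Color.other_other] using he')
    (by simpa only [Color.other_other] using hl)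
  simpa only [Color.other_other] using this

/-- An `i.other`-edge enters `v` because `t i.other` drops along the label 0 edge. If it had label
0, (A3) would complete a square ending at `v'`, and computing `t i.other v'` along its two sides
gives different values. `exists_zero_of_one` is the dual. -/
theorem exists_one_of_zero (D : WCData K t h) {i : Color} {v v' : K.V} (he : Zero h i v v') :
    ∃ u, One h i.other u v := by
  have h1 := D.zero_coord he
  obtain ⟨u, hu⟩ := D.exists_in (i := i.other) (v := v) (by omega)
  rcases D.zero_or_one hu with hz | ho
  · exfalso
    have h2 := D.zero_coord' hz
    obtain ⟨u', hu'⟩ := D.exists_out (i := i) (v := u) (by omega)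
    obtain ⟨h3, w, hw, hw'⟩ := D.square_out' hu hu' h2.2.2.2
    obtain rfl := D.out_unique he.1 hw
    have h4 := D.one_coord ⟨hu', h3⟩
    have h5 := D.t_succ hw'
    omega
  · exact ⟨u, ho⟩

theorem exists_zero_of_one (D : WCData K t h) {i : Color} {u v : K.V} (he : One h i.other u v) :
    ∃ w, Zero h i v w := by
  have h1 := D.one_coord' he
  obtain ⟨w, hw⟩ := D.exists_out (i := i) (v := v) (by omega)
  rcases D.zero_or_one hw with hz | ho
  · exact ⟨w, hz⟩
  · exfalso
    have h2 := D.one_coord ho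
    obtain ⟨z, hz⟩ := D.exists_in (i := i.other) (v := w) (by omega)
    obtain ⟨h3, x, hx, hx'⟩ := D.square_in hw hz h2.2.2.2
    obtain rfl := D.in_unique he.1 hx
    have h4 := D.zero_coord' ⟨hz, by rw [Color.other_other]; exact h3⟩
    have h5 := D.t_succ hx'
    omega

theorem LineCrit.crit (D : WCData K t h) {i : Color} {v : K.V} (hv : LineCrit h i v) :
    K.Crit h v := by
  intro k
  rcases Color.eq_or_eq_other i k with rfl | rfl
  · exact hv
  · refine ⟨fun u hu => ?_, fun w hw => ?_⟩
    · obtain ⟨w, hw⟩ := D.exists_zero_of_one hu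
      exact hv.2 w hw
    · obtain ⟨u, hu⟩ := D.exists_one_of_zero hw
      rw [Color.other_other] at hu
      exact hv.1 u hu

/-- In this and the next two squares opposite sides carry equal labels: `i`-sides 0, `i.other`-sides
1. They differ in which two sides are given, and the missing labels are found by comparing `h`
around the square. -/
theorem back_square (D : WCData K t h) {i : Color} {v v' w : K.V} (he : Zero h i v v')
    (hw : One h i.other w v') : ∃ u, One h i.other u v ∧ Zero h i u w := by
  have h1 := D.zero_coord he
  have h2 := D.one_coord' hw
  obtain ⟨-, z, hz, hz'⟩ := D.square_in' hw.1 he.1 h2.2.2.2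
  have h3 := D.h_succ hz
  have h4 := D.h_succ hz'
  exact ⟨z, ⟨hz', by rw [Color.other_other]; omega⟩, ⟨hz, by omega⟩⟩

theorem fwd_square (D : WCData K t h) {i : Color} {p q q' : K.V} (he : Zero h i p q)
    (hq : One h i.other q q') : ∃ p', One h i.other p p' ∧ Zero h i p' q' := by
  have h1 := D.zero_coord he
  have h2 := D.one_coord' hq
  obtain ⟨p', hp'⟩ := D.exists_out (i := i.other) (v := p) (by omega)
  obtain ⟨h3, w, hw, hw'⟩ := D.square_out he.1 hp' h1.2.2.2
  obtain rfl := D.out_unique hq.1 hw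
  have h4 := D.h_succ hp'
  exact ⟨p', ⟨hp', by rw [Color.other_other]; exact h3⟩, ⟨hw', by omega⟩⟩

theorem push_square (D : WCData K t h) {i : Color} {p q p' : K.V} (he : Zero h i p q)
    (hp : One h i.other p p') : ∃ q', One h i.other q q' ∧ Zero h i p' q' := by
  have h1 := D.zero_coord he
  have h2 := D.one_coord' hp
  obtain ⟨h3, w, hw, hw'⟩ := D.square_out he.1 hp.1 h1.2.2.2
  have h4 := D.h_succ hw
  have h5 := D.h_succ hw'
  exact ⟨w, ⟨hw, by rw [Color.other_other]; omega⟩, ⟨hw', by omega⟩⟩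

/-- A label 0 edge leaving `y` would be carried back across the corner to a label 0 edge leaving
`x`. The converse `crit_of_corner'` carries a label 1 edge entering `x` forward to one entering `y`.
-/
theorem crit_of_corner (D : WCData K t h) {i : Color} {x w y : K.V} (hx : K.Crit h x)
    (hxw : One h i.other x w) (hwy : Zero h i w y) : K.Crit h y := by
  refine LineCrit.crit D (i := i) ⟨fun u hu => ?_, fun z hz => ?_⟩
  · obtain rfl := D.in_unique hwy.1 hu.1
    have := hwy.2
    have := hu.2
    omega
  · obtain ⟨y', hy'⟩ := D.exists_one_of_zero hz
    obtain ⟨x', hx', hx''⟩ := D.back_square hwy hy'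
    obtain rfl := D.in_unique hxw.1 hx'.1
    exact (hx i).2 _ hx''

theorem crit_of_corner' (D : WCData K t h) {i : Color} {x w y : K.V} (hy : K.Crit h y)
    (hxw : One h i.other x w) (hwy : Zero h i w y) : K.Crit h x := by
  refine LineCrit.crit D (i := i.other) ⟨fun u hu => ?_, fun z hz => ?_⟩
  · obtain ⟨z, hz⟩ := D.exists_zero_of_one hu
    obtain ⟨q', hq', hq''⟩ := D.push_square hz hxw
    obtain rfl := D.out_unique hwy.1 hq''.1
    exact (hy i.other).1 _ hq'
  · obtain rfl := D.out_unique hxw.1 hz.1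
    have := hz.2
    have := hxw.2
    omega

theorem corner_back (D : WCData K t h) {i : Color} {w y : K.V} (hy : K.Crit h y)
    (hwy : Zero h i w y) : ∃ x, One h i.other x w ∧ K.Crit h x := by
  obtain ⟨x, hx⟩ := D.exists_one_of_zero hwy
  exact ⟨x, hx, D.crit_of_corner' hy hx hwy⟩

theorem corner_fwd (D : WCData K t h) {i : Color} {x w : K.V} (hx : K.Crit h x)
    (hxw : One h i.other x w) : ∃ y, Zero h i w y ∧ K.Crit h y := by
  obtain ⟨y, hy⟩ := D.exists_zero_of_one hxw
  exact ⟨y, hy, D.crit_of_corner hx hxw hy⟩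

/-! ### Positions of vertices in sails over the critical vertices -/

/-- The set of critical vertices. -/
abbrev CritV (h : Color → K.V → ℕ) : Type u := {v : K.V // K.Crit h v}

/-- The edges of direction `i` between critical vertices. -/
def CritRel (h : Color → K.V → ℕ) (i : Color) (x y : CritV h) : Prop :=
  ∃ w, One h i.other x.1 w ∧ Zero h i w y.1

theorem critRel_coord (D : WCData K t h) {i : Color} {x y : CritV h} (hR : CritRel h i x y) :
    t i y.1 = t i x.1 + 1 ∧ t i.other y.1 = t i.other x.1 ∧ h i y.1 = h i x.1 ∧
      h i.other x.1 = h i.other y.1 + 1 := by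
  obtain ⟨w, hw, hw'⟩ := hR
  have h1 := D.one_coord' hw
  have h2 := D.zero_coord hw'
  omega

theorem critRel_out_unique (D : WCData K t h) {i : Color} {x y y' : CritV h}
    (hR : CritRel h i x y) (hR' : CritRel h i x y') : y = y' := by
  obtain ⟨w, hw, hw'⟩ := hR
  obtain ⟨z, hz, hz'⟩ := hR'
  obtain rfl := D.out_unique hw.1 hz.1
  exact Subtype.ext (D.out_unique hw'.1 hz'.1)

theorem critRel_in_unique (D : WCData K t h) {i : Color} {x x' y : CritV h}
    (hR : CritRel h i x y) (hR' : CritRel h i x' y) : x = x' := by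
  obtain ⟨w, hw, hw'⟩ := hR
  obtain ⟨z, hz, hz'⟩ := hR'
  obtain rfl := D.in_unique hw'.1 hz'.1
  exact Subtype.ext (D.in_unique hw.1 hz.1)

/-- `v` is the vertex at position `(x, y)` of a sail of colour `i`. -/
def Pos (h : Color → K.V → ℕ) (i : Color) (v : K.V) (x y : CritV h) : Prop :=
  Relation.ReflTransGen (One h i.other) x.1 v ∧ Relation.ReflTransGen (Zero h i) v y.1

theorem Pos.refl {i : Color} (x : CritV h) : Pos h i x.1 x x :=
  ⟨Relation.ReflTransGen.refl, Relation.ReflTransGen.refl⟩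

/-- Squares slide the edge of label 0 back along the label 1 chain until it ends at `x'`; the corner
there supplies the critical vertex before `x'`. `Pos.push` is the dual at the other end. -/
theorem Pos.pull (D : WCData K t h) {i : Color} {v v' : K.V} {x' y : CritV h}
    (he : Zero h i v v') (hp : Pos h i v' x' y) : ∃ x, CritRel h i x x' ∧ Pos h i v x y := by
  obtain ⟨hA, hB⟩ := hp
  have key : ∃ u, Zero h i u x'.1 ∧ Relation.ReflTransGen (One h i.other) u v := by
    clear hB
    induction hA generalizing v with
    | refl => exact ⟨v, he, Relation.ReflTransGen.refl⟩
    | tail _ hw ih =>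
      obtain ⟨u, hu, hu'⟩ := D.back_square he hw
      obtain ⟨u0, h0, h0'⟩ := ih hu'
      exact ⟨u0, h0, h0'.tail hu⟩
  obtain ⟨u, hu, hu'⟩ := key
  obtain ⟨x, hx, hxc⟩ := D.corner_back x'.2 hu
  exact ⟨⟨x, hxc⟩, ⟨u, hx, hu⟩, hu'.head hx, hB.head he⟩

theorem Pos.push (D : WCData K t h) {i : Color} {v v' : K.V} {x y : CritV h}
    (he : One h i.other v v') (hp : Pos h i v x y) : ∃ y', CritRel h i y y' ∧ Pos h i v' x y' := by
  obtain ⟨hA, hB⟩ := hp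
  have key : ∃ w, One h i.other y.1 w ∧ Relation.ReflTransGen (Zero h i) v' w := by
    clear hA
    induction hB using Relation.ReflTransGen.head_induction_on generalizing v' with
    | refl => exact ⟨v', he, Relation.ReflTransGen.refl⟩
    | head hw _ ih =>
      obtain ⟨u, hu, hu'⟩ := D.push_square hw he
      obtain ⟨u0, h0, h0'⟩ := ih hu
      exact ⟨u0, h0, h0'.head hu'⟩
  obtain ⟨u, hu, hu'⟩ := key
  obtain ⟨y', hy, hyc⟩ := D.corner_fwd y.2 hu
  exact ⟨⟨y', hyc⟩, ⟨u, hu, hy⟩, hA.tail he, hu'.tail hy⟩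

theorem Pos.extend (D : WCData K t h) {i : Color} {v : K.V} {x y y' : CritV h}
    (hp : Pos h i v x y) (hR : CritRel h i y y') : ∃ v', One h i.other v v' ∧ Pos h i v' x y' := by
  obtain ⟨hA, hB⟩ := hp
  obtain ⟨w, hw, hw'⟩ := hR
  have key : ∃ v', One h i.other v v' ∧ Relation.ReflTransGen (Zero h i) v' w := by
    clear hA
    induction hB using Relation.ReflTransGen.head_induction_on with
    | refl => exact ⟨w, hw, Relation.ReflTransGen.refl⟩
    | head hz _ ih =>
      obtain ⟨u, hu, hu'⟩ := ih
      obtain ⟨u0, h0, h0'⟩ := D.fwd_square hz hu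
      exact ⟨u0, h0, hu'.head h0'⟩
  obtain ⟨v', hv, hv'⟩ := key
  exact ⟨v', hv, hA.tail hv, hv'.tail hw'⟩

theorem exists_pos_of_zero (D : WCData K t h) {i : Color} {v : K.V} {y : CritV h}
    (hB : Relation.ReflTransGen (Zero h i) v y.1) : ∃ x, Pos h i v x y := by
  induction hB using Relation.ReflTransGen.head_induction_on with
  | refl => exact ⟨y, Pos.refl y⟩
  | head hz _ ih =>
    obtain ⟨x, hx⟩ := ih
    obtain ⟨x', -, hx'⟩ := Pos.pull D hz hx
    exact ⟨x', hx'⟩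

theorem exists_pos_of_one (D : WCData K t h) {i : Color} {v : K.V} {x : CritV h}
    (hA : Relation.ReflTransGen (One h i.other) x.1 v) : ∃ y, Pos h i v x y := by
  induction hA with
  | refl => exact ⟨x, Pos.refl x⟩
  | tail _ hz ih =>
    obtain ⟨y, hy⟩ := ih
    obtain ⟨y', -, hy'⟩ := Pos.push D hz hy
    exact ⟨y', hy'⟩

theorem exists_pos (D : WCData K t h) (v : K.V) : ∃ i x y, Pos h i v x y := by
  obtain ⟨r, hr, hv | hv⟩ := D.exists_lineCrit .one v
  · obtain ⟨x, hx⟩ := D.exists_pos_of_zero (y := ⟨r, hr.crit D⟩) hv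
    exact ⟨_, _, _, hx⟩
  · obtain ⟨y, hy⟩ := D.exists_pos_of_one (i := .two) (x := ⟨r, hr.crit D⟩) hv
    exact ⟨_, _, _, hy⟩

theorem exists_pos_of_reach (D : WCData K t h) {i : Color} {x y : CritV h}
    (hr : Relation.ReflTransGen (CritRel h i) x y) : ∃ v, Pos h i v x y := by
  induction hr with
  | refl => exact ⟨x.1, Pos.refl x⟩
  | tail _ hR ih =>
    obtain ⟨v, hv⟩ := ih
    obtain ⟨v', -, hv'⟩ := hv.extend D hR
    exact ⟨v', hv'⟩

theorem one_reach_coord (D : WCData K t h) {i : Color} {x v : K.V}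
    (hA : Relation.ReflTransGen (One h i.other) x v) :
    t i v = t i x ∧ h i v + t i.other x = h i x + t i.other v ∧ t i.other x ≤ t i.other v ∧
      (x = v ∨ t i.other x < t i.other v) := by
  induction hA with
  | refl => exact ⟨rfl, rfl, le_rfl, Or.inl rfl⟩
  | tail _ he ih =>
    have := D.one_coord' he
    exact ⟨by omega, by omega, by omega, Or.inr (by omega)⟩

theorem zero_reach_coord (D : WCData K t h) {i : Color} {v y : K.V}
    (hB : Relation.ReflTransGen (Zero h i) v y) :
    t i v ≤ t i y ∧ h i v + t i v = h i y + t i y ∧ h i.other v = h i.other y := by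
  induction hB with
  | refl => exact ⟨le_rfl, rfl, rfl⟩
  | tail _ he ih =>
    have := D.zero_coord he
    omega

/-- The values `t i` at `x` and `t i + h i` at `y` fix `t i v` and `h i v`, hence also `t i.other
v`; this locates `v` on the label 1 chain leaving `x`. -/
theorem Pos.vertex_unique (D : WCData K t h) {i : Color} {v v' : K.V} {x y : CritV h}
    (hp : Pos h i v x y) (hp' : Pos h i v' x y) : v = v' := by
  have h1 := D.one_reach_coord hp.1
  have h2 := D.zero_reach_coord hp.2
  have h1' := D.one_reach_coord hp'.1
  have h2' := D.zero_reach_coord hp'.2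
  rcases Relation.ReflTransGen.total_of_right_unique
    (fun a b c hab hac => D.out_unique hab.1 hac.1) hp.1 hp'.1 with hv | hv
  · exact (D.one_reach_coord hv).2.2.2.resolve_right (by omega)
  · exact ((D.one_reach_coord hv).2.2.2.resolve_right (by omega)).symm

/-- Both chains are deterministic and cannot be prolonged past a critical vertex. -/
theorem Pos.unique (D : WCData K t h) {i : Color} {v : K.V} {x y x' y' : CritV h}
    (hp : Pos h i v x y) (hp' : Pos h i v x' y') : x = x' ∧ y = y' := by
  constructor
  · have h1 : Relation.ReflTransGen (Function.swap (One h i.other)) v x.1 := hp.1.swap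
    have h2 : Relation.ReflTransGen (Function.swap (One h i.other)) v x'.1 := hp'.1.swap
    rcases Relation.ReflTransGen.total_of_right_unique
      (fun a b c hab hac => D.in_unique hab.1 hac.1) h1 h2 with hv | hv
    · rcases Relation.ReflTransGen.cases_head hv with hv | ⟨z, hz, -⟩
      · exact Subtype.ext hv
      · exact absurd hz ((x.2 _).1 z)
    · rcases Relation.ReflTransGen.cases_head hv with hv | ⟨z, hz, -⟩
      · exact Subtype.ext hv.symm
      · exact absurd hz ((x'.2 _).1 z)
  · rcases Relation.ReflTransGen.total_of_right_unique
      (fun a b c hab hac => D.out_unique hab.1 hac.1) hp.2 hp'.2 with hv | hv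
    · rcases Relation.ReflTransGen.cases_head hv with hv | ⟨z, hz, -⟩
      · exact Subtype.ext hv
      · exact absurd hz ((y.2 _).2 z)
    · rcases Relation.ReflTransGen.cases_head hv with hv | ⟨z, hz, -⟩
      · exact Subtype.ext hv.symm
      · exact absurd hz ((y'.2 _).2 z)

theorem Pos.eq_of_crit (D : WCData K t h) {i : Color} {v : K.V} {x y : CritV h}
    (hp : Pos h i v x y) (hv : K.Crit h v) : x = ⟨v, hv⟩ ∧ y = ⟨v, hv⟩ :=
  hp.unique D (Pos.refl (i := i) ⟨v, hv⟩)

/-- Otherwise edges of label 0 of both colours would leave `v`, against (A3). -/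
theorem Pos.crit_of_other (D : WCData K t h) {i : Color} {v : K.V} {x y x' y' : CritV h}
    (hp : Pos h i v x y) (hp' : Pos h i.other v x' y') : K.Crit h v := by
  rcases Relation.ReflTransGen.cases_head hp.2 with hv | ⟨z, hz, -⟩
  · rw [hv]; exact y.2
  rcases Relation.ReflTransGen.cases_head hp'.2 with hv | ⟨z', hz', -⟩
  · rw [hv]; exact y'.2
  have h1 := (D.square_out hz.1 hz'.1 hz.2).1
  have h2 := hz'.2
  rw [Color.other_other] at h2
  omega

theorem Pos.reach (D : WCData K t h) {i : Color} {v : K.V} {x y : CritV h}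
    (hp : Pos h i v x y) : Relation.ReflTransGen (CritRel h i) x y := by
  obtain ⟨hA, hB⟩ := hp
  induction hB using Relation.ReflTransGen.head_induction_on generalizing x with
  | refl =>
    have hxy := (Pos.unique D (i := i) ⟨hA, Relation.ReflTransGen.refl⟩ (Pos.refl y)).1
    rw [hxy]
  | head hz hz' ih =>
    obtain ⟨x1, hx1⟩ := D.exists_pos_of_zero hz'
    obtain ⟨x2, hR, hx2⟩ := Pos.pull D hz hx1
    obtain rfl := (Pos.unique D hx2 ⟨hA, hz'.head hz⟩).1
    exact (ih hx1.1).head hR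

/-- `p` is the position of `v` in the sails over the critical vertices. -/
def Spec (h : Color → K.V → ℕ) (v : K.V) (p : CritV h × CritV h) : Prop :=
  ∃ i : Color, Pos h i v (i.other.proj p) (i.proj p)

theorem Pos.spec {i : Color} {v : K.V} {x y : CritV h} (hp : Pos h i v x y) :
    Spec h v (i.pair y x) := ⟨i, by simpa using hp⟩

theorem exists_spec (D : WCData K t h) (v : K.V) : ∃ p, Spec h v p := by
  obtain ⟨i, x, y, hp⟩ := D.exists_pos v
  exact ⟨_, hp.spec⟩

theorem Spec.unique (D : WCData K t h) {v : K.V} {p q : CritV h × CritV h} (hp : Spec h v p)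
    (hq : Spec h v q) : p = q := by
  obtain ⟨i, hp⟩ := hp
  obtain ⟨k, hq⟩ := hq
  rcases Color.eq_or_eq_other i k with rfl | rfl
  · have := hp.unique D hq
    exact k.proj_ext this.2 this.1
  · have hc := hp.crit_of_other D hq
    have h1 := hp.eq_of_crit D hc
    have h2 := hq.eq_of_crit D hc
    rw [Color.other_other] at h2
    exact i.proj_ext (h1.2.trans h2.1.symm) (h1.1.trans h2.2.symm)

theorem Spec.mem (D : WCData K t h) {v : K.V} {p : CritV h × CritV h} (hp : Spec h v p) :
    InSail (CritRel h) .one p ∨ InSail (CritRel h) .two p := by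
  obtain ⟨i, hp⟩ := hp
  exact InSail.mem (i := i) (hp.reach D)

theorem critRel_reach_coord (D : WCData K t h) {i : Color} {x y : CritV h}
    (hr : Relation.ReflTransGen (CritRel h i) x y) :
    (x = y ∨ t i x.1 < t i y.1) ∧ t i x.1 ≤ t i y.1 ∧ t i.other y.1 = t i.other x.1 := by
  induction hr with
  | refl => exact ⟨Or.inl rfl, le_rfl, rfl⟩
  | tail _ hR ih =>
    have := D.critRel_coord hR
    exact ⟨Or.inr (by omega), by omega, by omega⟩

/-- A position in a sail of colour `i` is a position with respect to `i`. -/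
theorem Spec.pos (D : WCData K t h) {i : Color} {v : K.V} {p : CritV h × CritV h}
    (hp : Spec h v p) (hs : InSail (CritRel h) i p) : Pos h i v (i.other.proj p) (i.proj p) := by
  obtain ⟨k, hp⟩ := hp
  rcases Color.eq_or_eq_other i k with rfl | rfl
  · exact hp
  · have h1 := D.critRel_reach_coord hs
    have h2 := D.critRel_reach_coord (hp.reach D)
    rw [Color.other_other] at h2 hp
    have hd : i.other.proj p = i.proj p := h1.1.resolve_right (by omega)
    rw [hd] at hp ⊢
    have := hp.vertex_unique D (Pos.refl _)
    subst this
    exact Pos.refl _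

theorem Spec.vertex_unique (D : WCData K t h) {v v' : K.V} {p : CritV h × CritV h}
    (hp : Spec h v p) (hp' : Spec h v' p) : v = v' := by
  obtain ⟨i, hi⟩ := hp
  exact hi.vertex_unique D (hp'.pos D (hi.reach D))

/-- An edge of label 0 belongs to a sail of its own colour and keeps `y`; one of label 1 belongs to
a sail of the other colour and keeps `x`. `Pos.pull` and `Pos.push` show that the other coordinate
makes one `CritRel` step. -/
theorem sailEdge_of_edge (D : WCData K t h) {i : Color} {v v' : K.V} {p p' : CritV h × CritV h}
    (hp : Spec h v p) (hp' : Spec h v' p') (he : K.E i v v') :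
    SailEdge (CritRel h) i p p' := by
  rcases D.zero_or_one he with hz | ho
  · obtain ⟨y, hy, hB⟩ := D.exists_lineCrit_of_zero hz
    obtain ⟨x', hx'⟩ := D.exists_pos_of_zero (y := ⟨y, hy.crit D⟩) hB
    obtain ⟨x, hR, hx⟩ := Pos.pull D hz hx'
    obtain rfl := hp.unique D hx.spec
    obtain rfl := hp'.unique D hx'.spec
    refine ⟨by simp, Or.inl ⟨?_, ?_, by simpa using hR⟩⟩
    · simpa [InSail] using hx.reach D
    · simpa [InSail] using hx'.reach D
  · obtain ⟨x, hx, hA⟩ := D.exists_lineCrit_of_one ho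
    obtain ⟨y, hy⟩ := D.exists_pos_of_one (i := i.other) (x := ⟨x, hx.crit D⟩)
      (by simpa only [Color.other_other] using hA)
    obtain ⟨y', hR, hy'⟩ := Pos.push D (by simpa only [Color.other_other] using ho) hy
    obtain rfl := hp.unique D hy.spec
    obtain rfl := hp'.unique D hy'.spec
    have hj : ∀ a b : CritV h, i.proj (i.other.pair a b) = b := fun a b => by
      have := i.other.proj_other_pair a b
      simpa only [Color.other_other] using this
    refine ⟨by rw [hj, hj], Or.inr ⟨?_, ?_, by simpa using hR⟩⟩
    · simpa [InSail, hj] using hy.reach D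
    · simpa [InSail, hj] using hy'.reach D

theorem edge_of_sailEdge (D : WCData K t h) {i : Color} {v v' : K.V} {p p' : CritV h × CritV h}
    (hp : Spec h v p) (hp' : Spec h v' p') (he : SailEdge (CritRel h) i p p') : K.E i v v' := by
  obtain ⟨heq, ⟨h1, h2, hR⟩ | ⟨h1, h2, hR⟩⟩ := he
  · have q := hp.pos D h1
    have q' := hp'.pos D h2
    rw [← heq] at q'
    have hc := D.critRel_coord hR
    -- If `v` were on the diagonal, the `CritRel` step would carry the moving coordinate beyond the
    -- fixed one, which it must still reach.
    rcases Relation.ReflTransGen.cases_head q.2 with hv | ⟨z, hz, hz'⟩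
    · exfalso
      have e1 := (q.eq_of_crit D (by rw [hv]; exact (i.proj p).2)).1
      have e2 := D.critRel_reach_coord (q'.reach D)
      have e3 : (i.other.proj p).1 = (i.proj p).1 := by rw [e1]; exact hv
      rw [e3] at hc
      omega
    · obtain ⟨x, hx⟩ := D.exists_pos_of_zero hz'
      obtain ⟨x', hR', hx'⟩ := Pos.pull D hz hx
      obtain rfl := (hx'.unique D q).1
      obtain rfl := D.critRel_out_unique hR hR'
      rw [← hx.vertex_unique D q']
      exact hz.1
  · have q := hp.pos D h1
    have q' := hp'.pos D h2
    rw [Color.other_other] at q q'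
    rw [← heq] at q'
    have hc := D.critRel_coord hR
    rcases Relation.ReflTransGen.cases_tail q'.1 with hv | ⟨z, hz, hz'⟩
    · exfalso
      have e1 := (q'.eq_of_crit D (by rw [hv]; exact (i.proj p).2)).2
      have e2 := D.critRel_reach_coord (q.reach D)
      have e3 : (i.other.proj p').1 = (i.proj p).1 := by rw [e1]; exact hv
      rw [e3] at hc
      omega
    · obtain ⟨y, hy⟩ := D.exists_pos_of_one hz
      obtain ⟨y', hR', hy'⟩ := Pos.push D hz' hy
      obtain rfl := (hy'.unique D q').2
      obtain rfl := D.critRel_in_unique hR hR'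
      rw [← hy.vertex_unique D q]
      have := hz'.1
      rwa [Color.other_other] at this

theorem isomorphic_sails (D : WCData K t h) : (sails (CritRel h)).Isomorphic K := by
  have hex : ∀ p : (sails (CritRel h)).V, ∃ v, Spec h v p.1 := by
    rintro ⟨p, hp⟩
    have hi : ∃ i, InSail (CritRel h) i p := hp.elim (fun h => ⟨_, h⟩) fun h => ⟨_, h⟩
    obtain ⟨i, hi⟩ := hi
    obtain ⟨v, hv⟩ := D.exists_pos_of_reach hi
    exact ⟨v, i, hv⟩
  choose f hf using hex
  have hbij : Function.Bijective f := by
    constructor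
    · intro p q hpq
      apply Subtype.ext
      have := hf p
      rw [hpq] at this
      exact this.unique D (hf q)
    · intro v
      obtain ⟨p, hp⟩ := D.exists_spec v
      exact ⟨⟨p, hp.mem D⟩, (hf _).vertex_unique D hp⟩
  exact ⟨Equiv.ofBijective f hbij, fun i p q =>
    ⟨fun he => D.sailEdge_of_edge (hf p) (hf q) he, fun he => D.edge_of_sailEdge (hf p) (hf q) he⟩⟩

/-- Send each vertex to the first coordinate of its position: a 1-edge moves it by one `CritRel`
step, a 2-edge fixes it, and a critical vertex is sent to itself. -/
theorem critRel_connected (D : WCData K t h) (hK : K.Connected) :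
    WeaklyConnected fun x y : CritV h => ∃ i, CritRel h i x y := by
  choose f hf using D.exists_spec
  obtain ⟨⟨v0⟩, hc⟩ := hK
  refine ⟨⟨(f v0).1⟩, fun x y => ?_⟩
  have key : ∀ u v, Relation.EqvGen (fun u v : K.V => ∃ i, K.E i u v) u v →
      Relation.EqvGen (fun x y : CritV h => ∃ i, CritRel h i x y) (f u).1 (f v).1 := by
    intro u v huv
    induction huv with
    | rel u v he =>
      obtain ⟨_ | _, he⟩ := he
      · obtain ⟨-, ⟨-, -, hR⟩ | ⟨-, -, hR⟩⟩ := D.sailEdge_of_edge (hf u) (hf v) he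
        · exact Relation.EqvGen.rel _ _ ⟨_, hR⟩
        · exact Relation.EqvGen.rel _ _ ⟨_, hR⟩
      · have heq : (f u).1 = (f v).1 := (D.sailEdge_of_edge (hf u) (hf v) he).1
        rw [heq]
        exact Relation.EqvGen.refl _
    | refl => exact Relation.EqvGen.refl _
    | symm _ _ _ ih => exact ih.symm
    | trans _ _ _ _ _ ih ih' => exact ih.trans _ _ _ ih'
  have hd : ∀ x : CritV h, (f x.1).1 = x := fun x =>
    congrArg Prod.fst ((hf x.1).unique D (Pos.refl (i := .two) x).spec)
  have := key x.1 y.1 (hc x.1 y.1)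
  rwa [hd, hd] at this

theorem gridSystem (D : WCData K t h) (hK : K.Connected) :
    ∃ n, GridSystem (CritRel h) (fun i (x : CritV h) => t i x.1) n := by
  obtain ⟨⟨x0⟩, hc⟩ := D.critRel_connected hK
  -- A step in direction `i` raises `t i` by one, lowers `h i.other` by one and fixes the other two
  -- values. The constant `t i + h i.other` is the size of the grid in direction `i`.
  have key : ∀ x y : CritV h, Relation.EqvGen (fun x y : CritV h => ∃ i, CritRel h i x y) x y →
      ∀ i : Color, t i x.1 + h i.other x.1 = t i y.1 + h i.other y.1 := by
    intro x y hxy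
    induction hxy with
    | rel x y hR =>
      obtain ⟨k, hR⟩ := hR
      intro i
      have := D.critRel_coord hR
      rcases Color.eq_or_eq_other k i with rfl | rfl
      · omega
      · rw [Color.other_other]; omega
    | refl => exact fun _ => rfl
    | symm _ _ _ ih => exact fun i => (ih i).symm
    | trans _ _ _ _ _ ih ih' => exact fun i => (ih i).trans (ih' i)
  refine ⟨fun i => t i x0.1 + h i.other x0.1, ?_⟩
  have hs : ∀ i (x : CritV h), t i x.1 + h i.other x.1 = t i x0.1 + h i.other x0.1 :=
    fun i x => key x x0 (hc x x0) i
  exact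
    { succ := fun hR => ⟨(D.critRel_coord hR).1, (D.critRel_coord hR).2.1⟩
      le := fun i x => by have := hs i x; omega
      out_unique := D.critRel_out_unique
      in_unique := D.critRel_in_unique
      exists_out := by
        intro i x hx
        have := hs i x
        obtain ⟨w, hw⟩ := D.exists_out (i := i.other) (v := x.1) (by omega)
        have ho := (D.zero_or_one hw).resolve_left ((x.2 i.other).2 w)
        obtain ⟨y, hy, hyc⟩ := D.corner_fwd x.2 ho
        exact ⟨⟨y, hyc⟩, w, ho, hy⟩
      exists_in := by
        intro i y hy
        obtain ⟨w, hw⟩ := D.exists_in (i := i) (v := y.1) hy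
        have hz := (D.zero_or_one hw).resolve_right ((y.2 i).1 w)
        obtain ⟨x, hx, hxc⟩ := D.corner_back y.2 hz
        exact ⟨⟨x, hxc⟩, w, hx, hz⟩ }

end TwoColoredDigraph.WCData

/-! ### Conclusion -/

/-- Every WC-graph arises from a covering over a grid by inserting sails. -/
theorem TwoColoredDigraph.IsWC.exists_covering {K : TwoColoredDigraph.{u}} (hK : K.IsWC) :
    ∃ C : GridCovering.{u}, C.sailGraph.Isomorphic K := by
  obtain ⟨n, S⟩ := hK.data.gridSystem hK.1
  obtain ⟨C, e, he⟩ := S.exists_covering (hK.data.critRel_connected hK.1)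
  obtain ⟨f, hf⟩ := hK.data.isomorphic_sails
  exact ⟨C, e.trans f, fun i x y => (hf i (e x) (e y)).trans (he i x y)⟩

theorem proposition3 :
    ∃ Φ : CoveringClass.{u} ≃ WCClass.{u},
      ∀ C : GridCovering.{u}, ∃ hC : C.sailGraph.IsWC,
        Φ (Quotient.mk coveringSetoid C) = Quotient.mk wcSetoid ⟨C.sailGraph, hC⟩ := by
  let F : CoveringClass.{u} → WCClass.{u} :=
    Quotient.map' (s₁ := coveringSetoid) (s₂ := wcSetoid)
      (fun C => ⟨C.sailGraph, C.sailGraph_isWC⟩)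
      (fun C D h => (GridCovering.isomorphic_sailGraph_iff C D).2 h)
  have hF : Function.Bijective F := by
    constructor
    · intro x y
      refine Quotient.inductionOn₂ x y fun C D h => ?_
      exact Quotient.sound (s := coveringSetoid)
        ((GridCovering.isomorphic_sailGraph_iff C D).1 (Quotient.exact (s := wcSetoid) h))
    · intro y
      refine Quotient.inductionOn y fun K => ?_
      obtain ⟨C, hC⟩ := K.2.exists_covering
      exact ⟨Quotient.mk coveringSetoid C, Quotient.sound (s := wcSetoid) hC⟩
  exact ⟨Equiv.ofBijective F hF, fun C => ⟨C.sailGraph_isWC, rfl⟩⟩
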